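/- For a convex body $K\subset\mathbb R^n$ (a non-empty compact convex set), let $B_2^n$ be the closed Euclidean unit ball, $\kappa_n=\mathrm{vol}(B_2^n)$, and let $\mathrm W_0(K),\dots,\mathrm W_n(K)$ be the quermassintegrals of $K$, i.e. the coefficients in the Steiner formula $\mathrm{vol}(K+\lambda B_2^n)=\sum_{i=0}^n\binom ni \mathrm W_i(K)\lambda^i$, $\lambda\ge 0$. The intrinsic volumes of $K$ are $\mathrm V_i(K)=\binom ni\,\mathrm W_{n-i}(K)/\kappa_{n-i}$, $i=0,\dots,n$, and the Wills functional is $\mathcal W(K)=\sum_{i=0}^n \mathrm V_i(K)$. The body $K$ is $0$-symmetric if $K=-K$, and it is in John position if the maximum volume ellipsoid contained in $K$ is $B_2^n$. **Theorem 1.4.** If $K\subset\mathbb R^n$ is a $0$-symmetric convex body in John position, then $$\mathcal W(K)\le \mathcal W\bigl([-1,1]^n\bigr).$$ -/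

import Mathlib

open scoped Pointwise
open MeasureTheory

noncomputable section

namespace Wills

/-- The `n`-dimensional Euclidean space. -/
abbrev Space (n : ℕ) : Type := EuclideanSpace ℝ (Fin n)

/-- The closed Euclidean unit ball of `ℝⁿ`. -/
def unitBall (n : ℕ) : Set (Space n) := Metric.closedBall 0 1

/-- `κₙ`, the volume of the unit ball of `ℝⁿ` (so `κ₀ = 1`). -/
def kappa (n : ℕ) : ℝ := volume.real (unitBall n)

/-- `w 0, …, w n` are the coefficients of the Steiner formula of `K`:
`vol (K + t B) = ∑ᵢ (n choose i) wᵢ tⁱ` for all `t ≥ 0`, with `B` the unit ball. -/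
def IsSteinerCoeff {n : ℕ} (K : ConvexBody (Space n)) (w : Fin (n + 1) → ℝ) : Prop :=
  ∀ t : ℝ, 0 ≤ t →
    volume.real ((K : Set (Space n)) + t • unitBall n) =
      ∑ i : Fin (n + 1), (n.choose i : ℝ) * w i * t ^ (i : ℕ)

open Classical in
/-- The quermassintegrals `Wᵢ(K)`, `0 ≤ i ≤ n`, i.e. the coefficients of the Steiner formula.
By Steiner's theorem they exist for every convex body, so the `else` branch is never taken;
they are unique by `quermassintegral_eq`. -/
def quermassintegral {n : ℕ} (K : ConvexBody (Space n)) : Fin (n + 1) → ℝ :=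
  if h : ∃ w, IsSteinerCoeff K w then h.choose else 0

/-- The Steiner formula determines its coefficients. -/
theorem IsSteinerCoeff.unique {n : ℕ} {K : ConvexBody (Space n)} {v w : Fin (n + 1) → ℝ}
    (hv : IsSteinerCoeff K v) (hw : IsSteinerCoeff K w) : v = w := by
  let p : (Fin (n + 1) → ℝ) → Polynomial ℝ := fun u =>
    ∑ i : Fin (n + 1), Polynomial.monomial (i : ℕ) ((n.choose i : ℝ) * u i)
  have hp : p v = p w := by
    apply Polynomial.eq_of_infinite_eval_eq
    refine (Set.Ici_infinite (0 : ℝ)).mono fun t ht => ?_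
    have h := (hv t ht).symm.trans (hw t ht)
    simpa [p, Polynomial.eval_finsetSum, Polynomial.eval_monomial] using h
  have hc : ∀ (u : Fin (n + 1) → ℝ) (j : Fin (n + 1)),
      (p u).coeff (j : ℕ) = (n.choose j : ℝ) * u j := by
    intro u j
    simp [p, Polynomial.coeff_monomial, Fin.val_inj]
  funext j
  have h := congrArg (fun q => Polynomial.coeff q (j : ℕ)) hp
  simp only [hc] at h
  have hj : (n.choose j : ℝ) ≠ 0 := by
    exact_mod_cast (Nat.choose_pos (Nat.lt_succ_iff.mp j.isLt)).ne'
  exact mul_left_cancel₀ hj h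

theorem quermassintegral_eq {n : ℕ} {K : ConvexBody (Space n)} {w : Fin (n + 1) → ℝ}
    (hw : IsSteinerCoeff K w) : quermassintegral K = w := by
  have h : ∃ w, IsSteinerCoeff K w := ⟨w, hw⟩
  rw [quermassintegral, dif_pos h]
  exact h.choose_spec.unique hw

/-- The intrinsic volumes `Vᵢ(K) = (n choose i) / κₙ₋ᵢ * Wₙ₋ᵢ(K)`, `0 ≤ i ≤ n`
(`Fin.rev i` is `n - i`). -/
def intrinsicVolume {n : ℕ} (K : ConvexBody (Space n)) (i : Fin (n + 1)) : ℝ :=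
  (n.choose i : ℝ) / kappa i.rev * quermassintegral K i.rev

/-- The Wills functional: the sum of the intrinsic volumes. -/
def wills {n : ℕ} (K : ConvexBody (Space n)) : ℝ :=
  ∑ i : Fin (n + 1), intrinsicVolume K i

/-- Ellipsoids: images of the unit ball under invertible affine maps. -/
def IsEllipsoid {n : ℕ} (E : Set (Space n)) : Prop :=
  ∃ (A : Space n ≃L[ℝ] Space n) (c : Space n), E = (fun x => A x + c) '' unitBall n

/-- `K` is in John position: the unit ball is an ellipsoid of maximum volume in `K`.
(The maximum volume ellipsoid of a body with interior points is unique.) -/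
def InJohnPosition {n : ℕ} (K : ConvexBody (Space n)) : Prop :=
  unitBall n ⊆ K ∧
    ∀ E : Set (Space n), IsEllipsoid E → E ⊆ K → volume E ≤ volume (unitBall n)

/-- The cube `[-1,1]ⁿ`. -/
def cube (n : ℕ) : ConvexBody (Space n) where
  carrier := {x | ∀ i, x i ∈ Set.Icc (-1 : ℝ) 1}
  convex' := by
    intro x hx y hy a b ha hb hab i
    exact convex_Icc (-1 : ℝ) 1 (hx i) (hy i) ha hb hab
  isCompact' := by
    have h : IsCompact (Set.univ.pi fun _ : Fin n => Set.Icc (-1 : ℝ) 1) :=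
      isCompact_univ_pi fun _ => isCompact_Icc
    have h2 := h.image (PiLp.continuous_toLp 2 (fun _ : Fin n => ℝ))
    convert h2 using 1
    ext x
    constructor
    · intro hx
      exact ⟨x.ofLp, fun i _ => hx i, rfl⟩
    · rintro ⟨y, hy, rfl⟩ i
      exact hy i (Set.mem_univ i)
  nonempty' := ⟨0, fun i => by simp⟩

end Wills

end

/-! The proof rests on Hadwiger's formula: the Wills functional of `K` is the integral over space of
exp(-π d(x, K)²). It follows from Steiner's formula by writing the exponential as an integral over
the parallel bodies of `K`. Since `quermassintegral` defaults to 0 when no Steiner coefficients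
exist, Steiner's formula is itself proved: adding a segment makes volume affine in its length, hence
polynomial for zonotopes, and zonotopes approximate the ball.

John's theorem gives unit vectors `u i` and weights `c i ≥ 0` with Σ c_i u_i ⊗ u_i = I, such that
⟪u_i, ·⟫ ≤ 1 on `K`. By symmetry `K` lies in every slab |⟪u_i, ·⟫| ≤ 1. If y is the point of `K`
nearest to x, then d(x, K)² = Σ c_i ⟪u_i, x - y⟫² is at least Σ c_i max(|⟪u_i, x⟫| - 1, 0)². So the
integrand is at most ∏ φ(⟪u_i, x⟫)^{c_i}, with φ the profile of [-1,1] (`intervalProfile`).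

Ball's form of the Brascamp–Lieb inequality (`lintegral_prod_rpow_le`) bounds the integral of this
product by (∫ φ)^{Σ c_i} = (∫ φ)^n, because Σ c_i is the trace of the identity. For the cube the
integrand is at least the product of the φ(x_i), so (∫ φ)^n is at most its Wills functional. -/

noncomputable section

namespace Wills

open Set Filter Topology
open scoped RealInnerProductSpace

/-! ### Volumes of sums with segments and zonotopes -/

section Steiner

variable {E : Type*} [NormedAddCommGroup E] [InnerProductSpace ℝ E]

theorem mem_add_smul_segment {K : Set E} {v x : E} {t : ℝ} (ht : 0 ≤ t) :
    x ∈ K + t • segment ℝ 0 v ↔ ∃ k ∈ K, ∃ r ∈ Icc 0 t, k + r • v = x := by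
  have h : t • segment ℝ 0 v = (fun r : ℝ => r • v) '' Icc 0 t := by
    rw [segment_eq_image, ← image_smul, image_image]
    rcases ht.eq_or_lt with rfl | ht
    · simp
    · ext y
      constructor
      · rintro ⟨r, hr, rfl⟩
        exact ⟨t * r, ⟨mul_nonneg ht.le hr.1, mul_le_of_le_one_right ht.le hr.2⟩,
          by simp [mul_smul]⟩
      · rintro ⟨r, hr, rfl⟩
        exact ⟨r / t, ⟨div_nonneg hr.1 ht.le, (div_le_one ht).2 hr.2⟩,
          by simp [smul_smul, mul_div_cancel₀ _ ht.ne']⟩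
  rw [h, Set.mem_add]
  simp

theorem isCompact_segment (v w : E) : IsCompact (segment ℝ v w) := by
  rw [segment_eq_image]
  exact isCompact_Icc.image (by fun_prop)

omit [InnerProductSpace ℝ E] in
theorem isCompact_finset_sum {ι : Type*} (s : Finset ι) (f : ι → Set E)
    (hf : ∀ i ∈ s, IsCompact (f i)) : IsCompact (∑ i ∈ s, f i) := by
  classical
  induction s using Finset.induction_on with
  | empty => simp
  | insert a s ha ih =>
    rw [Finset.sum_insert ha]
    exact (hf a (by simp)).add (ih fun i hi => hf i (by simp [hi]))

variable [FiniteDimensional ℝ E] [MeasurableSpace E] [BorelSpace E]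

/-- Inclusion–exclusion: `K + (s + t)[0, v]` is the union of `K + s[0, v]` and the translate by `s •
v` of `K + t[0, v]`; by convexity these two overlap exactly in `K + s • v`. -/
theorem volume_add_smul_segment_add {K : Set E} (hK : IsCompact K) (hc : Convex ℝ K) (v : E)
    {s t : ℝ} (hs : 0 ≤ s) (ht : 0 ≤ t) :
    volume.real (K + (s + t) • segment ℝ 0 v) + volume.real K =
      volume.real (K + s • segment ℝ 0 v) + volume.real (K + t • segment ℝ 0 v) := by
  have hcomp : ∀ r : ℝ, IsCompact (K + r • segment ℝ 0 v) := fun r =>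
    hK.add ((isCompact_segment 0 v).smul r)
  set A := K + s • segment ℝ 0 v
  set B := (fun x => x + s • v) '' (K + t • segment ℝ 0 v)
  have hBc : IsCompact B := (hcomp t).image (by fun_prop)
  have hun : A ∪ B = K + (s + t) • segment ℝ 0 v := by
    ext x
    simp only [A, B, mem_union, mem_image, mem_add_smul_segment hs, mem_add_smul_segment ht,
      mem_add_smul_segment (add_nonneg hs ht)]
    constructor
    · rintro (⟨k, hk, r, hr, rfl⟩ | ⟨_, ⟨k, hk, r, hr, rfl⟩, rfl⟩)
      · exact ⟨k, hk, r, ⟨hr.1, by linarith [hr.2]⟩, rfl⟩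
      · exact ⟨k, hk, r + s, ⟨by linarith [hr.1], by linarith [hr.2]⟩, by module⟩
    · rintro ⟨k, hk, r, hr, rfl⟩
      rcases le_total r s with h | h
      · exact Or.inl ⟨k, hk, r, ⟨hr.1, h⟩, rfl⟩
      · exact Or.inr ⟨_, ⟨k, hk, r - s, ⟨by linarith, by linarith [hr.2]⟩, rfl⟩, by module⟩
  have hin : A ∩ B = (fun x => x + s • v) '' K := by
    ext x
    simp only [A, B, mem_inter_iff, mem_image, mem_add_smul_segment hs, mem_add_smul_segment ht]
    constructor
    · rintro ⟨⟨k, hk, r, hr, rfl⟩, ⟨_, ⟨k', hk', r', hr', rfl⟩, h⟩⟩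
      refine ⟨k + (r - s) • v, ?_, by module⟩
      rcases (show 0 ≤ (s - r) + r' by linarith [hr.2, hr'.1]).eq_or_lt with h0 | h0
      · have : r = s := by linarith [hr.2, hr'.1]
        simpa [this] using hk
      · have hk2 : k' = k + (r - s - r') • v := by
          have : k' = (k' + r' • v + s • v) - r' • v - s • v := by module
          rw [this, h]; module
        -- The point `k + (r - s) • v` divides the segment from `k` to `k' = k + (r - s - r') • v`,
        -- and these are its barycentric weights.
        have := hc hk hk' (a := r' / ((s - r) + r')) (b := (s - r) / ((s - r) + r'))
          (div_nonneg hr'.1 h0.le) (div_nonneg (by linarith [hr.2]) h0.le)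
          (by field_simp; ring)
        convert this using 1
        rw [hk2, smul_add, ← add_assoc, ← add_smul, smul_smul]
        congr 1
        · rw [show r' / ((s - r) + r') + (s - r) / ((s - r) + r') = 1 by field_simp; ring,
            one_smul]
        · congr 1; field_simp; ring
    · rintro ⟨k, hk, rfl⟩
      exact ⟨⟨k, hk, s, ⟨hs, le_rfl⟩, rfl⟩, ⟨k, ⟨k, hk, 0, ⟨le_rfl, ht⟩, by simp⟩, rfl⟩⟩
  have htr : ∀ S : Set E, volume.real ((fun x => x + s • v) '' S) = volume.real S := by
    intro S
    simp [Measure.real, measure_preimage_add_right]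
  have := measureReal_union_add_inter (μ := volume) (s := A) hBc.measurableSet
    (hcomp s).measure_lt_top.ne hBc.measure_lt_top.ne
  rw [hun, hin, htr, htr] at this
  exact this

theorem linear_of_additive_of_monotone {h : ℝ → ℝ}
    (hadd : ∀ s t, 0 ≤ s → 0 ≤ t → h (s + t) = h s + h t)
    (hmono : ∀ s t, 0 ≤ s → s ≤ t → h s ≤ h t) {t : ℝ} (ht : 0 ≤ t) : h t = t * h 1 := by
  have h0 : h 0 = 0 := by simpa using hadd 0 0 le_rfl le_rfl
  have hn : ∀ (s : ℝ), 0 ≤ s → ∀ N : ℕ, h (N * s) = N * h s := by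
    intro s hs N
    induction N with
    | zero => simp [h0]
    | succ N ih =>
      push_cast
      rw [add_mul, one_mul, hadd _ _ (by positivity) hs, ih]; ring
  have h1 : 0 ≤ h 1 := h0 ▸ hmono 0 1 le_rfl zero_le_one
  -- Monotonicity places `h (N t)` between the values of `h` at the two integers around `N t`, so
  -- the error stays bounded as `N` grows.
  have key : ∀ N : ℕ, N * |h t - t * h 1| ≤ h 1 := by
    intro N
    have hNt : 0 ≤ (N : ℝ) * t := by positivity
    have hl := hmono (⌊(N : ℝ) * t⌋₊ * 1) (N * t) (by positivity) (by
      simpa using Nat.floor_le hNt)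
    have hu := hmono (N * t) ((⌊(N : ℝ) * t⌋₊ + 1 : ℕ) * 1) hNt (by
      push_cast; simpa using (Nat.lt_floor_add_one _).le)
    rw [hn _ zero_le_one, hn t ht] at hl
    rw [hn _ zero_le_one, hn t ht] at hu
    push_cast at hu
    have a := Nat.floor_le hNt
    have b := Nat.lt_floor_add_one ((N : ℝ) * t)
    have : (N : ℝ) * |h t - t * h 1| = |N * h t - N * t * h 1| := by
      conv_lhs => rw [← abs_of_nonneg (Nat.cast_nonneg (α := ℝ) N), ← abs_mul]
      ring_nf
    rw [this, abs_le]
    constructor <;> nlinarith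
  by_contra hne
  have hpos : 0 < |h t - t * h 1| := abs_pos.2 (sub_ne_zero.2 hne)
  obtain ⟨N, hN⟩ := exists_nat_gt (h 1 / |h t - t * h 1|)
  rw [div_lt_iff₀ hpos] at hN
  linarith [key N]

theorem volume_real_mono_of_isCompact {s t : Set E} (h : s ⊆ t) (ht : IsCompact t) :
    volume.real s ≤ volume.real t :=
  measureReal_mono h ht.measure_lt_top.ne

/-- The volume of `K + t • [0, v]` is an affine function of `t ≥ 0`. -/
theorem volume_add_smul_segment {K : Set E} (hK : IsCompact K) (hc : Convex ℝ K) (v : E)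
    {t : ℝ} (ht : 0 ≤ t) :
    volume.real (K + t • segment ℝ 0 v) =
      volume.real K + t * (volume.real (K + segment ℝ 0 v) - volume.real K) := by
  have := linear_of_additive_of_monotone
    (h := fun t => volume.real (K + t • segment ℝ 0 v) - volume.real K) (t := t) ?_ ?_ ht
  · simp only [one_smul] at this
    linarith
  · intro a b ha hb
    have := volume_add_smul_segment_add hK hc v ha hb
    linarith
  · intro a b ha hab
    refine sub_le_sub_right (volume_real_mono_of_isCompact ?_
      (hK.add ((isCompact_segment 0 v).smul b))) _
    intro x hx
    rw [mem_add_smul_segment ha] at hx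
    rw [mem_add_smul_segment (ha.trans hab)]
    obtain ⟨k, hk, r, hr, rfl⟩ := hx
    exact ⟨k, hk, r, ⟨hr.1, hr.2.trans hab⟩, rfl⟩

/-- The volume of `K + t • Z` is a polynomial in `t ≥ 0` for a zonotope `Z`. -/
theorem exists_polynomial_volume_add_smul_zonotope {ι : Type*} (s : Finset ι) (v : ι → E) :
    ∀ {K : Set E}, IsCompact K → Convex ℝ K → ∃ p : Polynomial ℝ, ∀ t : ℝ, 0 ≤ t →
      volume.real (K + t • ∑ i ∈ s, segment ℝ 0 (v i)) = p.eval t := by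
  classical
  induction s using Finset.induction_on with
  | empty =>
    intro K _ _
    exact ⟨Polynomial.C (volume.real K), fun t _ => by simp⟩
  | insert a s ha ih =>
    intro K hK hc
    obtain ⟨p, hp⟩ := ih hK hc
    obtain ⟨q, hq⟩ := ih (hK.add (isCompact_segment 0 (v a))) (hc.add (convex_segment _ _))
    -- With the other segments scaled by `t` already added, volume is affine in the length of the
    -- last one; `p` and `q` give its values at lengths 0 and 1.
    refine ⟨p + Polynomial.X * (q - p), fun t ht => ?_⟩
    have hZ : IsCompact (∑ i ∈ s, segment ℝ 0 (v i)) :=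
      isCompact_finset_sum _ _ fun i _ => isCompact_segment _ _
    have hZc : Convex ℝ (∑ i ∈ s, segment ℝ 0 (v i)) :=
      convex_sum _ fun i _ => convex_segment _ _
    rw [Finset.sum_insert ha, smul_add, add_comm (t • segment ℝ 0 (v a)), ← add_assoc,
      volume_add_smul_segment (hK.add (hZ.smul t)) (hc.add (hZc.smul t)) _ ht, hp t ht,
      add_right_comm, hq t ht]
    simp

theorem natDegree_le_of_eval_le {p : Polynomial ℝ} {n : ℕ} {a b : ℝ}
    (h0 : ∀ t : ℝ, 0 ≤ t → 0 ≤ p.eval t)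
    (h : ∀ t : ℝ, 0 ≤ t → p.eval t ≤ a * (b + t) ^ n) : p.natDegree ≤ n := by
  by_contra! hlt
  have hp : p ≠ 0 := by rintro rfl; simp at hlt
  set q : Polynomial ℝ := Polynomial.C a * (Polynomial.C b + Polynomial.X) ^ n
  have hq : q.degree < p.degree := by
    rw [Polynomial.degree_eq_natDegree hp]
    refine lt_of_le_of_lt (b := (n : WithBot ℕ)) ?_ (by exact_mod_cast hlt)
    refine Polynomial.degree_le_of_natDegree_le ((Polynomial.natDegree_C_mul_le _ _).trans ?_)
    refine Polynomial.natDegree_pow_le.trans ?_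
    rw [add_comm, Polynomial.natDegree_X_add_C, mul_one]
  have h1 := Polynomial.isLittleO_atTop_of_degree_lt q p hq
  have h2 : (fun x => Polynomial.eval x p) =O[atTop] fun x => Polynomial.eval x q := by
    refine Asymptotics.IsBigO.of_bound 1 ?_
    filter_upwards [eventually_ge_atTop 0] with t ht
    have := h t ht
    have h' := h0 t ht
    simp only [q, Polynomial.eval_mul, Polynomial.eval_pow, Polynomial.eval_add,
      Polynomial.eval_C, Polynomial.eval_X, Real.norm_eq_abs, one_mul]
    rw [abs_of_nonneg h', abs_of_nonneg (h'.trans this)]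
    exact this
  have h3 := h2.trans_isLittleO h1
  refine Asymptotics.isLittleO_irrefl ?_ h3
  exact (p.eventually_atTop_not_isRoot hp).frequently

end Steiner

/-! ### Zonotopes approximating the ball, and Steiner's formula -/

section Ball


variable {E : Type*} [NormedAddCommGroup E] [InnerProductSpace ℝ E] [FiniteDimensional ℝ E]

/-- A point outside of a closed convex set is separated from it by a unit vector. -/
theorem exists_unit_inner_lt {K : Set E} (hc : Convex ℝ K) (hK : IsClosed K) (hne : K.Nonempty)
    {x : E} (hx : x ∉ K) : ∃ θ : E, ‖θ‖ = 1 ∧ ∃ a : ℝ, (∀ y ∈ K, ⟪θ, y⟫ < a) ∧ a < ⟪θ, x⟫ := by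
  obtain ⟨f, a, hf, hfx⟩ := geometric_hahn_banach_closed_point hc hK hx
  set ψ := (InnerProductSpace.toDual ℝ E).symm f
  have hψ : ∀ y, ⟪ψ, y⟫ = f y := fun y => by simp [ψ]
  have hψ0 : 0 < ‖ψ‖ := by
    rw [norm_pos_iff]
    intro h
    obtain ⟨y, hy⟩ := hne
    have h1 := hf y hy
    rw [← hψ, h, inner_zero_left] at h1
    rw [← hψ, h, inner_zero_left] at hfx
    linarith
  refine ⟨‖ψ‖⁻¹ • ψ, by simp [norm_smul, hψ0.ne'], ‖ψ‖⁻¹ * a, fun y hy => ?_, ?_⟩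
  · rw [real_inner_smul_left, hψ]
    exact mul_lt_mul_of_pos_left (hf y hy) (inv_pos.2 hψ0)
  · rw [real_inner_smul_left, hψ]
    exact mul_lt_mul_of_pos_left hfx (inv_pos.2 hψ0)

/-- The sum in the hypothesis is the support function of the zonotope, and 1 is that of the ball; a
separating direction would contradict their order. -/
theorem closedBall_subset_zonotope {ι : Type*} (s : Finset ι) (v : ι → E)
    (h : ∀ θ : E, ‖θ‖ = 1 → 1 ≤ ∑ i ∈ s, max ⟪θ, v i⟫ 0) :
    Metric.closedBall (0 : E) 1 ⊆ ∑ i ∈ s, segment ℝ 0 (v i) := by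
  intro x hx
  by_contra hxZ
  obtain ⟨θ, hθ, a, ha, hax⟩ := exists_unit_inner_lt
    (convex_sum _ fun i _ => convex_segment (𝕜 := ℝ) 0 (v i))
    (isCompact_finset_sum s _ fun i _ => isCompact_segment 0 (v i)).isClosed
    ⟨0, (Set.mem_finsetSum _ _ _).2 ⟨0, fun {i} _ => left_mem_segment _ _ _, by simp⟩⟩ hxZ
  have hz := ha (∑ i ∈ s, if 0 < ⟪θ, v i⟫ then v i else 0) <|
    (Set.mem_finsetSum _ _ _).2 ⟨_, fun {i} _ => by
      split_ifs
      · exact right_mem_segment _ _ _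
      · exact left_mem_segment _ _ _, rfl⟩
  rw [inner_sum] at hz
  have hsum : ∑ i ∈ s, ⟪θ, if 0 < ⟪θ, v i⟫ then v i else 0⟫ = ∑ i ∈ s, max ⟪θ, v i⟫ 0 := by
    refine Finset.sum_congr rfl fun i _ => ?_
    split_ifs with hi
    · rw [max_eq_left hi.le]
    · rw [max_eq_right (not_lt.1 hi), inner_zero_right]
  have h1 := h θ hθ
  have h2 := real_inner_le_norm θ x
  rw [mem_closedBall_zero_iff] at hx
  rw [hθ, one_mul] at h2
  linarith

omit [FiniteDimensional ℝ E] in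
theorem zonotope_subset_closedBall {ι : Type*} (s : Finset ι) (v : ι → E) {R : ℝ} (hR : 0 ≤ R)
    (h : ∀ θ : E, ‖θ‖ = 1 → ∑ i ∈ s, max ⟪θ, v i⟫ 0 ≤ R) :
    ∑ i ∈ s, segment ℝ 0 (v i) ⊆ Metric.closedBall (0 : E) R := by
  intro z hz
  obtain ⟨g, hg, hgz⟩ := (Set.mem_finsetSum _ _ _).1 hz
  rw [mem_closedBall_zero_iff]
  rcases eq_or_ne z 0 with rfl | hz0
  · simpa using hR
  have hn : 0 < ‖z‖ := norm_pos_iff.2 hz0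
  refine le_trans ?_ (h (‖z‖⁻¹ • z) (by simp [norm_smul, hn.ne']))
  calc ‖z‖ = ⟪‖z‖⁻¹ • z, z⟫ := by
        rw [real_inner_smul_left, real_inner_self_eq_norm_sq]; field_simp
    _ = ∑ i ∈ s, ⟪‖z‖⁻¹ • z, g i⟫ := by rw [← inner_sum, hgz]
    _ ≤ _ := by
        refine Finset.sum_le_sum fun i hi => ?_
        have := hg hi
        rw [segment_eq_image] at this
        obtain ⟨r, hr, hrg⟩ := this
        rw [← hrg]
        simp only [smul_zero, zero_add]
        rw [real_inner_smul_right]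
        rcases le_total 0 ⟪‖z‖⁻¹ • z, v i⟫ with h0 | h0
        · exact (mul_le_of_le_one_left h0 hr.2).trans (le_max_left _ _)
        · exact (mul_nonpos_of_nonneg_of_nonpos hr.1 h0).trans (le_max_right _ _)

variable [MeasurableSpace E] [BorelSpace E]

/-- The reflection taking `θ` to `η` preserves the ball and the volume. Hence the average over `u`
of the support functions of [0, u] is constant on the sphere, like the support function of a ball.
-/
theorem setIntegral_posPart_inner_eq {θ η : E} (h : ‖θ‖ = ‖η‖) :
    ∫ u in Metric.closedBall (0 : E) 1, max ⟪θ, u⟫ 0 =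
      ∫ u in Metric.closedBall (0 : E) 1, max ⟪η, u⟫ 0 := by
  set R := (ℝ ∙ (θ - η))ᗮ.reflection
  have hR : R θ = η := Submodule.reflection_sub h
  have hm : MeasurePreserving R volume volume := R.measurePreserving
  have := hm.setIntegral_preimage_emb R.toHomeomorph.measurableEmbedding
    (fun u => max ⟪η, u⟫ 0) (Metric.closedBall 0 1)
  rw [← this]
  have hpre : R ⁻¹' Metric.closedBall (0 : E) 1 = Metric.closedBall 0 1 := by
    ext u; simp
  rw [hpre]
  refine integral_congr_ae (Eventually.of_forall fun u => ?_)
  simp only [← hR, LinearIsometryEquiv.inner_map_map]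

theorem setIntegral_posPart_inner_pos {θ : E} (h : θ ≠ 0) :
    0 < ∫ u in Metric.closedBall (0 : E) 1, max ⟪θ, u⟫ 0 := by
  have hcont : Continuous fun u : E => max ⟪θ, u⟫ 0 := by fun_prop
  rw [setIntegral_pos_iff_support_of_nonneg_ae (f := fun u => max ⟪θ, u⟫ 0) (Eventually.of_forall fun u => le_max_right _ _)
    (hcont.continuousOn.integrableOn_compact (isCompact_closedBall _ _))]
  have hn : 0 < ‖θ‖ := norm_pos_iff.2 h
  have hopen : IsOpen ({u : E | 0 < ⟪θ, u⟫} ∩ Metric.ball 0 1) :=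
    (isOpen_lt continuous_const (by fun_prop)).inter Metric.isOpen_ball
  refine (hopen.measure_pos volume ⟨(2 * ‖θ‖)⁻¹ • θ, ?_, ?_⟩).trans_le (measure_mono ?_)
  · simp only [Set.mem_ofPred_eq, real_inner_smul_right, real_inner_self_eq_norm_sq]
    positivity
  · rw [mem_ball_zero_iff, norm_smul, norm_inv, norm_mul, norm_norm, mul_inv, mul_assoc,
      inv_mul_cancel₀ hn.ne']
    norm_num
  · rintro u ⟨hu, hu'⟩
    refine ⟨?_, Metric.ball_subset_closedBall hu'⟩
    rw [Function.mem_support]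
    exact (lt_max_of_lt_left hu).ne'

/-- The unit ball is approximated by zonotopes. -/
theorem exists_zonotope_near_closedBall {ε : ℝ} (hε : 0 < ε) :
    ∃ (ι : Type) (s : Finset ι) (v : ι → E),
      Metric.closedBall (0 : E) 1 ⊆ ∑ i ∈ s, segment ℝ 0 (v i) ∧
      ∑ i ∈ s, segment ℝ 0 (v i) ⊆ Metric.closedBall (0 : E) (1 + ε) := by
  suffices ∃ (ι : Type) (s : Finset ι) (v : ι → E), ∀ θ : E, ‖θ‖ = 1 →
      1 ≤ ∑ i ∈ s, max ⟪θ, v i⟫ 0 ∧ ∑ i ∈ s, max ⟪θ, v i⟫ 0 ≤ 1 + ε by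
    obtain ⟨ι, s, v, h⟩ := this
    exact ⟨ι, s, v, closedBall_subset_zonotope s v fun θ hθ => (h θ hθ).1,
      zonotope_subset_closedBall s v (by linarith) fun θ hθ => (h θ hθ).2⟩
  by_cases hE : ∃ θ : E, ‖θ‖ = 1
  swap
  · exact ⟨Unit, ∅, 0, fun θ hθ => (hE ⟨θ, hθ⟩).elim⟩
  obtain ⟨θ₀, hθ₀⟩ := hE
  set D := Metric.closedBall (0 : E) 1
  let S := Metric.sphere (0 : E) 1
  let φ : E → C(S, ℝ) := fun u => ⟨fun θ => max ⟪(θ : E), u⟫ 0, by fun_prop⟩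
  have hφ : Continuous φ := by
    refine ContinuousMap.continuous_of_continuous_uncurry _ ?_
    simp only [φ, Function.uncurry_def, ContinuousMap.coe_mk]
    fun_prop
  have hD : IsCompact D := isCompact_closedBall _ _
  have hDpos : 0 < volume D :=
    (Metric.measure_ball_pos volume 0 one_pos).trans_le (measure_mono Metric.ball_subset_closedBall)
  have hint : IntegrableOn φ D := hφ.continuousOn.integrableOn_compact hD
  set c : ℝ := (volume.real D)⁻¹ * ∫ u in D, max ⟪θ₀, u⟫ 0
  have hc : 0 < c := mul_pos (inv_pos.2 (ENNReal.toReal_pos hDpos.ne' hD.measure_lt_top.ne))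
    (setIntegral_posPart_inner_pos (by rintro rfl; simp at hθ₀))
  -- The average, taken in `C(S, ℝ)`, lies in the closed convex hull of the functions `φ u`. Finite
  -- convex combinations, which are support functions of zonotopes, therefore approximate it
  -- uniformly on the sphere.
  have hmem := (convex_convexHull ℝ (range φ)).set_average_mem_closure (μ := volume) (t := D)
    hDpos.ne' hD.measure_lt_top.ne
    (Eventually.of_forall fun u => subset_convexHull ℝ _ (mem_range_self u)) hint
  have hval : ∀ θ : S, (⨍ u in D, φ u) θ = c := by
    intro θ
    rw [setAverage_eq, ContinuousMap.smul_apply,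
      ← ContinuousMap.evalCLM_apply (R := ℝ), ← ContinuousLinearMap.integral_comp_comm _ hint]
    simp only [ContinuousMap.evalCLM_apply, φ, ContinuousMap.coe_mk, smul_eq_mul, c]
    rw [setIntegral_posPart_inner_eq (θ := (θ : E)) (η := θ₀)
      (by rw [hθ₀]; exact mem_sphere_zero_iff_norm.1 θ.2)]
  -- Chosen so that (c + δ) / (c - δ) = 1 + ε; dividing by `c - δ` then puts the support function
  -- between 1 and 1 + ε.
  set δ := c * ε / (2 + ε)
  have hδ : 0 < δ := by positivity
  have hδc : 0 < c - δ := by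
    have : c - δ = 2 * c / (2 + ε) := by simp only [δ]; field_simp; ring
    rw [this]; positivity
  obtain ⟨g, hg, hdist⟩ := Metric.mem_closure_iff.1 hmem δ hδ
  rw [mem_convexHull_iff_exists_fintype] at hg
  obtain ⟨ι, _, w, z, hw, -, hz, rfl⟩ := hg
  choose u hu using hz
  refine ⟨ι, Finset.univ, fun i => (w i / (c - δ)) • u i, fun θ hθ => ?_⟩
  have hθS : θ ∈ S := mem_sphere_zero_iff_norm.2 hθ
  have hsum : ∑ i, max ⟪θ, (w i / (c - δ)) • u i⟫ 0 =
      (∑ i, w i • z i) ⟨θ, hθS⟩ / (c - δ) := by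
    rw [ContinuousMap.sum_apply, Finset.sum_div]
    refine Finset.sum_congr rfl fun i _ => ?_
    have hwi : 0 ≤ w i / (c - δ) := div_nonneg (hw i) hδc.le
    rw [real_inner_smul_right, ← hu i, ContinuousMap.smul_apply, smul_eq_mul]
    simp only [φ, ContinuousMap.coe_mk]
    rw [mul_div_right_comm, mul_max_of_nonneg _ _ hwi, mul_zero]
  have hd := (ContinuousMap.dist_apply_le_dist (f := ⨍ u in D, φ u) (g := ∑ i, w i • z i)
    ⟨θ, hθS⟩).trans_lt hdist
  rw [hval, Real.dist_eq, abs_lt] at hd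
  rw [hsum, le_div_iff₀ hδc, div_le_iff₀ hδc]
  refine ⟨by linarith, ?_⟩
  have : (1 + ε) * (c - δ) = c + δ := by simp only [δ]; field_simp; ring
  linarith

omit [FiniteDimensional ℝ E] [MeasurableSpace E] [BorelSpace E] in
theorem add_smul_unit_closedBall_eq_cthickening {K : Set E} (hK : IsCompact K) {t : ℝ}
    (ht : 0 ≤ t) : K + t • Metric.closedBall (0 : E) 1 = Metric.cthickening t K := by
  rw [smul_closedBall _ _ zero_le_one, smul_zero, mul_one, Real.norm_of_nonneg ht,
    hK.add_closedBall_zero ht]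

/-- The volume of the parallel body is right continuous in the radius. -/
theorem tendsto_volume_parallel_body {K : Set E} (hK : IsCompact K) {t : ℝ} (ht : 0 ≤ t)
    {r : ℕ → ℝ} (hr : ∀ k, t ≤ r k) (hrt : Tendsto r atTop (𝓝 t)) :
    Tendsto (fun k => volume.real (K + r k • Metric.closedBall (0 : E) 1)) atTop
      (𝓝 (volume.real (K + t • Metric.closedBall (0 : E) 1))) := by
  have h := tendsto_measure_cthickening_of_isCompact (μ := volume) (hK.cthickening (r := t))
  have h2 : Tendsto (fun k => r k - t) atTop (𝓝 0) := by simpa using hrt.sub_const t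
  have h3 := (ENNReal.tendsto_toReal (hK.cthickening (r := t)).measure_lt_top.ne).comp
    (h.comp h2)
  rw [add_smul_unit_closedBall_eq_cthickening hK ht]
  refine h3.congr fun k => ?_
  simp only [Function.comp]
  rw [cthickening_cthickening (by linarith [hr k]) ht,
    add_smul_unit_closedBall_eq_cthickening hK (ht.trans (hr k)), sub_add_cancel]
  rfl

/-- **Steiner's formula**. -/
theorem exists_steiner_polynomial {K : Set E} (hK : IsCompact K) (hc : Convex ℝ K) :
    ∃ p : Polynomial ℝ, p.natDegree ≤ Module.finrank ℝ E ∧ ∀ t : ℝ, 0 ≤ t →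
      volume.real (K + t • Metric.closedBall (0 : E) 1) = p.eval t := by
  set n := Module.finrank ℝ E
  set B := Metric.closedBall (0 : E) 1
  set f : ℝ → ℝ := fun t => volume.real (K + t • B)
  have hB : IsCompact B := isCompact_closedBall _ _
  have hlim : ∀ k : ℕ, ∃ p : Polynomial ℝ, p.natDegree ≤ n ∧ ∀ t : ℝ, 0 ≤ t →
      f t ≤ p.eval t ∧ p.eval t ≤ f (t * (1 + 1 / ((k : ℝ) + 1))) := by
    intro k
    set ε := 1 / ((k : ℝ) + 1)
    have hε : 0 < ε := by positivity
    obtain ⟨ι, s, v, h1, h2⟩ := exists_zonotope_near_closedBall (E := E) hε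
    obtain ⟨p, hp⟩ := exists_polynomial_volume_add_smul_zonotope s v hK hc
    have hZ : IsCompact (∑ i ∈ s, segment ℝ 0 (v i)) :=
      isCompact_finset_sum _ _ fun i _ => isCompact_segment _ _
    have hball : (1 + ε) • B = Metric.closedBall (0 : E) (1 + ε) := by
      simp only [B]
      rw [smul_closedBall _ _ zero_le_one, smul_zero, mul_one, Real.norm_of_nonneg (by positivity)]
    have hle : ∀ t : ℝ, 0 ≤ t → f t ≤ p.eval t ∧ p.eval t ≤ f (t * (1 + ε)) := by
      intro t ht
      rw [← hp t ht]
      refine ⟨volume_real_mono_of_isCompact (add_subset_add_left (smul_set_mono h1))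
        (hK.add (hZ.smul t)), volume_real_mono_of_isCompact (add_subset_add_left ?_)
        (hK.add (hB.smul _))⟩
      rw [mul_smul, hball]
      exact smul_set_mono h2
    refine ⟨p, ?_, hle⟩
    -- Enclosing `K` in a ball shows growth of order at most t^n, which bounds the degree uniformly
    -- in `k`.
    obtain ⟨R, hR0, hR⟩ := hK.isBounded.subset_closedBall_lt 0 0
    refine natDegree_le_of_eval_le (a := (1 + ε) ^ n * volume.real B) (b := R / (1 + ε))
      (fun t ht => measureReal_nonneg.trans (hle t ht).1) fun t ht => (hle t ht).2.trans ?_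
    have : K + (t * (1 + ε)) • B ⊆ Metric.closedBall 0 (R + t * (1 + ε)) := by
      simp only [B]
      rw [smul_closedBall _ _ zero_le_one, smul_zero, mul_one,
        Real.norm_of_nonneg (by positivity)]
      refine (add_subset_add_right hR).trans ?_
      rw [closedBall_add_closedBall hR0.le (by positivity), add_zero]
    refine (volume_real_mono_of_isCompact this (isCompact_closedBall _ _)).trans ?_
    rw [Measure.addHaar_real_closedBall' _ _ (by positivity)]
    have h3 : R + t * (1 + ε) = (1 + ε) * (R / (1 + ε) + t) := by field_simp
    rw [h3, mul_pow]
    exact le_of_eq (by ring)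
  choose p hpn hp using hlim
  have htend : ∀ t : ℝ, 0 ≤ t → Tendsto (fun k => (p k).eval t) atTop (𝓝 (f t)) := by
    intro t ht
    refine tendsto_of_tendsto_of_tendsto_of_le_of_le tendsto_const_nhds
      (tendsto_volume_parallel_body hK ht (r := fun k : ℕ => t * (1 + 1 / ((k : ℝ) + 1)))
        (fun k => le_mul_of_one_le_right ht (by simp; positivity)) ?_)
      (fun k => (hp k t ht).1) (fun k => (hp k t ht).2)
    simpa using (tendsto_one_div_add_atTop_nhds_zero_nat (𝕜 := ℝ)).const_add 1 |>.const_mul t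
  have hinj : InjOn (fun i : ℕ => (i : ℝ)) (Finset.range (n + 1) : Set ℕ) :=
    fun _ _ _ _ h => Nat.cast_injective h
  refine ⟨Lagrange.interpolate (Finset.range (n + 1)) (fun i : ℕ => (i : ℝ)) fun i => f i,
    ?_, fun t ht => ?_⟩
  · rw [← Nat.lt_succ_iff]
    by_cases h0 : Lagrange.interpolate (Finset.range (n + 1)) (fun i : ℕ => (i : ℝ))
      (fun i => f i) = 0
    · rw [h0]; simp
    · rw [Polynomial.natDegree_lt_iff_degree_lt h0]
      simpa using Lagrange.degree_interpolate_lt (fun i : ℕ => f i) hinj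
  -- Polynomials of degree at most `n` are determined by their values at 0, …, n, so convergence at
  -- these nodes identifies the limit at every `t`.
  · refine tendsto_nhds_unique (htend t ht) ?_
    have hpk : ∀ k, (p k).eval t = ∑ i ∈ Finset.range (n + 1), (p k).eval (i : ℝ) *
        (Lagrange.basis (Finset.range (n + 1)) (fun i : ℕ => (i : ℝ)) i).eval t := by
      intro k
      have hdeg : (p k).degree < (Finset.range (n + 1)).card := by
        rw [Finset.card_range]
        exact (Polynomial.degree_le_of_natDegree_le (hpn k)).trans_lt (by exact_mod_cast n.lt_succ_self)
      conv_lhs => rw [Lagrange.eq_interpolate hinj hdeg]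
      simp [Lagrange.interpolate_apply, Polynomial.eval_finsetSum]
    simp only [hpk, Lagrange.interpolate_apply, Polynomial.eval_finsetSum, Polynomial.eval_mul,
      Polynomial.eval_C]
    exact tendsto_finsetSum _ fun i _ => (htend i (Nat.cast_nonneg i)).mul_const _

end Ball

/-! ### Gaussian moments and Hadwiger's formula -/

theorem exists_isSteinerCoeff {n : ℕ} (K : ConvexBody (Space n)) : ∃ w, IsSteinerCoeff K w := by
  obtain ⟨p, hpn, hp⟩ := exists_steiner_polynomial K.isCompact K.convex
  rw [finrank_euclideanSpace_fin] at hpn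
  refine ⟨fun i => p.coeff i / n.choose i, fun t ht => ?_⟩
  rw [unitBall, hp t ht, Polynomial.eval_eq_sum_range' (Nat.lt_succ_iff.2 hpn),
    ← Fin.sum_univ_eq_sum_range (fun i => p.coeff i * t ^ i)]
  refine Finset.sum_congr rfl fun i _ => ?_
  have : (n.choose i : ℝ) ≠ 0 := by
    exact_mod_cast (Nat.choose_pos (Nat.lt_succ_iff.mp i.isLt)).ne'
  field_simp

theorem isSteinerCoeff_quermassintegral {n : ℕ} (K : ConvexBody (Space n)) :
    IsSteinerCoeff K (quermassintegral K) := by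
  obtain ⟨w, hw⟩ := exists_isSteinerCoeff K
  rwa [quermassintegral_eq hw]

theorem kappa_eq (i : ℕ) : kappa i = Real.sqrt Real.pi ^ i / Real.Gamma (i / 2 + 1) := by
  rcases Nat.eq_zero_or_pos i with rfl | hi
  · simp [kappa, unitBall, Measure.real, volume_euclideanSpace_eq_dirac]
  · have : Nonempty (Fin i) := ⟨⟨0, hi⟩⟩
    rw [kappa, unitBall, Measure.real, EuclideanSpace.volume_closedBall]
    simp only [ENNReal.ofReal_one, one_pow, one_mul, Fintype.card_fin]
    rw [ENNReal.toReal_ofReal]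
    exact div_nonneg (by positivity) (Real.Gamma_pos_of_pos (by positivity)).le

theorem integrableOn_pow_succ_mul_exp (i : ℕ) :
    IntegrableOn (fun t : ℝ => 2 * Real.pi * t * Real.exp (-Real.pi * t ^ 2) * t ^ i) (Ioi 0) := by
  have h := integrableOn_rpow_mul_exp_neg_mul_sq Real.pi_pos
    (s := ((i + 1 : ℕ) : ℝ)) (by positivity |> (neg_one_lt_zero.trans ·))
  simp_rw [Real.rpow_natCast] at h
  refine IntegrableOn.congr_fun (h.const_mul (2 * Real.pi)) (fun t _ => ?_) measurableSet_Ioi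
  ring

/-- The density is minus the derivative of exp(-π t²). Its moments produce exactly the factors 1/κ_i
by which intrinsic volumes differ from quermassintegrals. -/
theorem integral_pow_succ_mul_exp (i : ℕ) :
    ∫ t : ℝ in Ioi 0, 2 * Real.pi * t * Real.exp (-Real.pi * t ^ 2) * t ^ i = (kappa i)⁻¹ := by
  have h := integral_rpow_mul_exp_neg_mul_rpow (p := 2) (q := ((i + 1 : ℕ) : ℝ)) (b := Real.pi)
    two_pos (neg_one_lt_zero.trans (by positivity)) Real.pi_pos
  simp_rw [Real.rpow_natCast, Real.rpow_two] at h
  have h2 : ∀ t : ℝ, 2 * Real.pi * t * Real.exp (-Real.pi * t ^ 2) * t ^ i =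
      2 * Real.pi * (t ^ (i + 1) * Real.exp (-Real.pi * t ^ 2)) := fun t => by ring
  simp_rw [h2]
  rw [integral_const_mul, h, kappa_eq, inv_div]
  have h3 : (((i + 1 : ℕ) : ℝ) + 1) / 2 = i / 2 + 1 := by push_cast; ring
  have h4 : -(((i + 1 : ℕ) : ℝ) + 1) / 2 = -((i : ℝ) / 2) - 1 := by push_cast; ring
  have h5 : Real.sqrt Real.pi ^ i = Real.pi ^ ((i : ℝ) / 2) := by
    rw [Real.sqrt_eq_rpow, ← Real.rpow_natCast, ← Real.rpow_mul Real.pi_pos.le]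
    ring_nf
  rw [h3, h4, h5, Real.rpow_sub_one Real.pi_pos.ne', Real.rpow_neg Real.pi_pos.le]
  have := Real.pi_pos.ne'
  field_simp

theorem lintegral_Ioi_gaussian_tail {d : ℝ} (hd : 0 ≤ d) :
    ∫⁻ t in Ioi d, ENNReal.ofReal (2 * Real.pi * t * Real.exp (-Real.pi * t ^ 2)) =
      ENNReal.ofReal (Real.exp (-Real.pi * d ^ 2)) := by
  have hder : ∀ x ∈ Ici d, HasDerivAt (fun t : ℝ => -Real.exp (-Real.pi * t ^ 2))
      (2 * Real.pi * x * Real.exp (-Real.pi * x ^ 2)) x := by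
    intro x _
    have := (((hasDerivAt_pow 2 x).const_mul (-Real.pi)).exp).neg
    refine HasDerivAt.congr_deriv this ?_
    push_cast; ring
  have hpos : ∀ x ∈ Ioi d, 0 ≤ 2 * Real.pi * x * Real.exp (-Real.pi * x ^ 2) := by
    intro x hx
    have : 0 < x := hd.trans_lt hx
    positivity
  have hlim : Tendsto (fun t : ℝ => -Real.exp (-Real.pi * t ^ 2)) atTop (𝓝 0) := by
    rw [← neg_zero]
    refine (Real.tendsto_exp_atBot.comp ?_).neg
    exact (tendsto_pow_atTop two_ne_zero).const_mul_atTop_of_neg (by simp [Real.pi_pos])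
  rw [← ofReal_integral_eq_lintegral_ofReal (integrableOn_Ioi_deriv_of_nonneg' hder hpos hlim)
    ((ae_restrict_iff' measurableSet_Ioi).2 (Eventually.of_forall hpos)),
    integral_Ioi_of_hasDerivAt_of_nonneg' hder hpos hlim]
  simp

/-- **Hadwiger's formula** for the Wills functional. -/
theorem lintegral_exp_neg_infDist_sq {n : ℕ} (K : ConvexBody (Space n)) :
    ∫⁻ x, ENNReal.ofReal (Real.exp (-Real.pi * Metric.infDist x (K : Set (Space n)) ^ 2)) =
      ENNReal.ofReal (wills K) := by
  set d : Space n → ℝ := fun x => Metric.infDist x (K : Set (Space n))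
  have hd0 : ∀ x, 0 ≤ d x := fun x => Metric.infDist_nonneg
  have hdm : Measurable d := (Metric.continuous_infDist_pt _).measurable
  set h : ℝ → ℝ := fun t => 2 * Real.pi * t * Real.exp (-Real.pi * t ^ 2)
  have hhm : Measurable h := by fun_prop
  have hh0 : ∀ t, 0 ≤ t → 0 ≤ h t := fun t ht => by positivity
  -- Layer cake: exp(-π d²) is the integral of `h` over t ≥ d. Exchanging the integrals leaves the
  -- volumes of the parallel bodies {d ≤ t}.
  have h1 : ∀ x, ENNReal.ofReal (Real.exp (-Real.pi * d x ^ 2)) =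
      ∫⁻ t in Ici 0, {p : Space n × ℝ | d p.1 ≤ p.2}.indicator
        (fun p => ENNReal.ofReal (h p.2)) (x, t) := by
    intro x
    rw [← lintegral_Ioi_gaussian_tail (hd0 x), ← setLIntegral_congr Ioi_ae_eq_Ici.symm]
    have : ∀ t, {p : Space n × ℝ | d p.1 ≤ p.2}.indicator
        (fun p => ENNReal.ofReal (h p.2)) (x, t) =
        (Ici (d x)).indicator (fun t => ENNReal.ofReal (h t)) t := fun t => rfl
    rw [lintegral_congr this, setLIntegral_indicator measurableSet_Ici, Ici_inter_Ici, sup_eq_left.2 (hd0 x)]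
  have hset : MeasurableSet {p : Space n × ℝ | d p.1 ≤ p.2} :=
    measurableSet_le (hdm.comp measurable_fst) measurable_snd
  have hvol : ∀ t, 0 ≤ t → volume {x | d x ≤ t} = ENNReal.ofReal
      (∑ i : Fin (n + 1), (n.choose i : ℝ) * quermassintegral K i * t ^ (i : ℕ)) := by
    intro t ht
    rw [← isSteinerCoeff_quermassintegral K t ht, unitBall,
      add_smul_unit_closedBall_eq_cthickening K.isCompact ht, Measure.real,
      ENNReal.ofReal_toReal K.isCompact.cthickening.measure_lt_top.ne]
    congr 1
    ext x
    rw [Metric.mem_cthickening_iff, ENNReal.le_ofReal_iff_toReal_le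
      (Metric.infEDist_ne_top K.nonempty) ht]
    rfl
  rw [lintegral_congr h1]
  rw [lintegral_lintegral_swap (f := fun x t => {p : Space n × ℝ | d p.1 ≤ p.2}.indicator
        (fun p => ENNReal.ofReal (h p.2)) (x, t))
    ((Measurable.indicator (by fun_prop) hset).aemeasurable)]
  have h2 : ∀ t ∈ Ici (0 : ℝ), ∫⁻ x, {p : Space n × ℝ | d p.1 ≤ p.2}.indicator
        (fun p => ENNReal.ofReal (h p.2)) (x, t) = ENNReal.ofReal
      (∑ i : Fin (n + 1), (n.choose i : ℝ) * quermassintegral K i * (h t * t ^ (i : ℕ))) := by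
    intro t ht
    have : ∀ x, {p : Space n × ℝ | d p.1 ≤ p.2}.indicator
        (fun p => ENNReal.ofReal (h p.2)) (x, t) =
        {x | d x ≤ t}.indicator (fun _ => ENNReal.ofReal (h t)) x := fun x => rfl
    simp_rw [this]
    rw [lintegral_indicator_const (measurableSet_le hdm measurable_const), hvol t ht,
      ← ENNReal.ofReal_mul (hh0 t ht), Finset.mul_sum]
    congr 1
    exact Finset.sum_congr rfl fun i _ => by ring
  rw [setLIntegral_congr_fun measurableSet_Ici h2, setLIntegral_congr Ioi_ae_eq_Ici.symm]
  have hint : ∀ i ∈ (Finset.univ : Finset (Fin (n + 1))), IntegrableOn (fun t => (n.choose i : ℝ) * quermassintegral K i *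
      (h t * t ^ (i : ℕ))) (Ioi 0) := fun i _ =>
    (integrableOn_pow_succ_mul_exp i).const_mul _
  rw [← ofReal_integral_eq_lintegral_ofReal (integrable_finsetSum _ hint), integral_finsetSum _ hint]
  · congr 1
    rw [wills, ← Equiv.sum_comp Fin.revPerm]
    refine Finset.sum_congr rfl fun i _ => ?_
    rw [integral_const_mul, integral_pow_succ_mul_exp, intrinsicVolume, Fin.revPerm_apply,
      Fin.val_rev, show n + 1 - (i + 1 : ℕ) = n - i by omega,
      Nat.choose_symm (Nat.lt_succ_iff.mp i.isLt)]
    ring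
  · refine (ae_restrict_iff' measurableSet_Ioi).2 (Eventually.of_forall fun t ht => ?_)
    have ht0 : 0 ≤ t := le_of_lt ht
    have : ∑ i : Fin (n + 1), (n.choose i : ℝ) * quermassintegral K i * (h t * t ^ (i : ℕ)) =
        h t * ∑ i : Fin (n + 1), (n.choose i : ℝ) * quermassintegral K i * t ^ (i : ℕ) := by
      rw [Finset.mul_sum]
      exact Finset.sum_congr rfl fun i _ => by ring
    simp only [Pi.zero_apply]
    rw [this, ← isSteinerCoeff_quermassintegral K t ht0]
    exact mul_nonneg (hh0 t ht0) measureReal_nonneg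

/-- In finite dimension the convex hull of a compact set is compact. -/
theorem isCompact_convexHull {F : Type*} [NormedAddCommGroup F] [NormedSpace ℝ F]
    [FiniteDimensional ℝ F] {s : Set F} (hs : IsCompact s) : IsCompact (convexHull ℝ s) := by
  rcases s.eq_empty_or_nonempty with rfl | ⟨s₀, hs₀⟩
  · simp
  set N := Module.finrank ℝ F + 1
  suffices convexHull ℝ s = (fun p : (Fin N → ℝ) × (Fin N → F) => ∑ i, p.1 i • p.2 i) ''
      (stdSimplex ℝ (Fin N) ×ˢ Set.univ.pi fun _ => s) by
    rw [this]
    exact ((isCompact_stdSimplex ℝ (Fin N)).prod (isCompact_univ_pi fun _ => hs)).image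
      (by fun_prop)
  apply Subset.antisymm
  · intro x hx
    -- Carathéodory: affine independence allows at most `N` points; the list is padded to length `N`
    -- by `s₀` with weight 0.
    obtain ⟨ι, _, z, w, hz, haff, hw, hw1, rfl⟩ := eq_pos_convex_span_of_mem_convexHull hx
    have hcard : Fintype.card ι ≤ Fintype.card (Fin N) := by
      rw [Fintype.card_fin]
      exact haff.card_le_finrank_succ.trans (Nat.succ_le_succ (Submodule.finrank_le _))
    obtain ⟨e⟩ := Function.Embedding.nonempty_of_card_le hcard
    refine ⟨(Function.extend e w 0, Function.extend e z fun _ => s₀), ⟨⟨fun j => ?_, ?_⟩,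
      fun j _ => ?_⟩, ?_⟩
    · by_cases hj : ∃ i, e i = j
      · obtain ⟨i, rfl⟩ := hj
        simpa [e.injective.extend_apply] using (hw i).le
      · simp [Function.extend_apply' _ _ _ hj]
    · rw [← hw1]
      exact Finset.sum_of_injOn e e.injective.injOn (fun _ _ => by simp)
        (fun j _ hj => by
          simp [Function.extend_apply' (f := e) w 0 j (by simpa using hj)])
        (fun i _ => by simp [e.injective.extend_apply]) |>.symm
    · by_cases hj : ∃ i, e i = j
      · obtain ⟨i, rfl⟩ := hj
        simpa [e.injective.extend_apply] using hz (mem_range_self i)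
      · simpa [Function.extend_apply' _ _ _ hj] using hs₀
    · exact Finset.sum_of_injOn e e.injective.injOn (fun _ _ => by simp)
        (fun j _ hj => by
          simp [Function.extend_apply' (f := e) w 0 j (by simpa using hj)])
        (fun i _ => by simp [e.injective.extend_apply]) |>.symm
  · rintro _ ⟨⟨w, z⟩, ⟨hw, hz⟩, rfl⟩
    exact (convex_convexHull ℝ s).sum_mem (fun i _ => hw.1 i) hw.2
      fun i _ => subset_convexHull ℝ s (hz i (mem_univ i))

/-! ### John position: contact points and decomposition of the identity -/

theorem det_toEuclideanCLM {n : ℕ} (A : Matrix (Fin n) (Fin n) ℝ) :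
    LinearMap.det (Matrix.toEuclideanCLM (𝕜 := ℝ) A : Space n →ₗ[ℝ] Space n) = A.det := by
  rw [Matrix.coe_toEuclideanCLM_eq_toEuclideanLin]
  change LinearMap.det (Matrix.toLpLin 2 2 A) = _
  rw [Matrix.toLpLin_eq_toLin, LinearMap.det_toLin]


/-- The derivative of the determinant at the identity is the trace; `q` collects the terms of order
at least two. -/
theorem exists_pos_det_one_add_smul_gt {n : ℕ} {M : Matrix (Fin n) (Fin n) ℝ}
    (hM : 0 < M.trace) : ∃ δ > (0 : ℝ), ∀ ε : ℝ, 0 < ε → ε < δ → 1 < (1 + ε • M).det := by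
  set q := (1 + (Polynomial.X : Polynomial ℝ) • M.map Polynomial.C).det.divX.divX
  have hcont : ContinuousAt (fun ε : ℝ => M.trace + q.eval ε * ε) 0 := by fun_prop
  have hpos : ∀ᶠ ε in 𝓝 (0 : ℝ), 0 < M.trace + q.eval ε * ε :=
    hcont.eventually_const_lt (by simpa using hM)
  obtain ⟨δ, hδ, h⟩ := Metric.eventually_nhds_iff.1 hpos
  refine ⟨δ, hδ, fun ε h0 hε => ?_⟩
  have := h (y := ε) (by simpa [abs_of_pos h0] using hε)
  rw [Matrix.det_one_add_smul]
  nlinarith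

/-- The first order optimality condition for the unit ball as ellipsoid of maximum volume. -/
theorem InJohnPosition.exists_contact {n : ℕ} {K : ConvexBody (Space n)} (hK : InJohnPosition K)
    (M : Matrix (Fin n) (Fin n) ℝ) (hM : 0 < M.trace) :
    ∃ u : Space n, ‖u‖ = 1 ∧ (∀ x ∈ K, ⟪u, x⟫ ≤ 1) ∧
      0 ≤ ⟪u, Matrix.toEuclideanCLM (𝕜 := ℝ) M u⟫ := by
  set L : Space n →L[ℝ] Space n := Matrix.toEuclideanCLM (𝕜 := ℝ) M
  have hball : ∀ b : Space n, ‖b‖ ≤ 1 → b ∈ K := fun b hb =>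
    hK.1 (mem_closedBall_zero_iff.2 hb)
  obtain ⟨δ, hδ, hdet⟩ := exists_pos_det_one_add_smul_gt hM
  set ε : ℕ → ℝ := fun k => δ / ((k : ℝ) + 2)
  have hε0 : ∀ k, 0 < ε k := fun k => by positivity
  have hεδ : ∀ k, ε k < δ := fun k => div_lt_self hδ (by linarith [Nat.cast_nonneg (α := ℝ) k])
  have hεlim : Tendsto ε atTop (𝓝 0) :=
    Tendsto.const_div_atTop (tendsto_atTop_add_const_right _ _ tendsto_natCast_atTop_atTop) δ
  have key : ∀ k, ∃ θ b : Space n, ‖θ‖ = 1 ∧ ‖b‖ ≤ 1 ∧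
      ∀ y ∈ K, ⟪θ, y⟫ ≤ ⟪θ, b⟫ + ε k * ⟪θ, L b⟫ := by
    intro k
    set A : Space n →L[ℝ] Space n := Matrix.toEuclideanCLM (𝕜 := ℝ) (1 + ε k • M)
    have hA : ∀ b, A b = b + ε k • L b := by intro b; simp [A, L]
    have hAdet : 1 < LinearMap.det (A : Space n →ₗ[ℝ] Space n) := by
      rw [det_toEuclideanCLM]; exact hdet _ (hε0 k) (hεδ k)
    have hAne : A.det ≠ 0 := (zero_lt_one.trans hAdet).ne'
    have hell : IsEllipsoid (A '' unitBall n) :=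
      ⟨A.toContinuousLinearEquivOfDetNeZero hAne, 0, by
        simp⟩
    -- The perturbed ellipsoid has larger volume than the ball, so it leaves `K`, and a point `A b`
    -- outside can be separated from `K`.
    have hnot : ¬ (A '' unitBall n ⊆ K) := by
      intro hsub
      have h1 := hK.2 _ hell hsub
      rw [Measure.addHaar_image_continuousLinearMap] at h1
      have hv0 : volume (unitBall n) ≠ 0 :=
        ((Metric.measure_ball_pos volume (0 : Space n) one_pos).trans_le
          (measure_mono Metric.ball_subset_closedBall)).ne'
      have hvt : volume (unitBall n) ≠ ⊤ := (isCompact_closedBall _ _).measure_lt_top.ne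
      have h2 : ENNReal.ofReal |LinearMap.det (A : Space n →ₗ[ℝ] Space n)| ≤ 1 := by
        by_contra! hlt
        have := ENNReal.mul_lt_mul_left hv0 hvt hlt
        rw [one_mul] at this
        exact absurd h1 (not_le.2 this)
      rw [ENNReal.ofReal_le_one, abs_of_pos (by linarith)] at h2
      linarith
    obtain ⟨_, ⟨b, hb, rfl⟩, hbK⟩ := not_subset.1 hnot
    obtain ⟨θ, hθ, a, ha, hab⟩ := exists_unit_inner_lt K.convex K.isClosed K.nonempty hbK
    refine ⟨θ, b, hθ, mem_closedBall_zero_iff.1 hb, fun y hy => ?_⟩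
    rw [hA, inner_add_right, real_inner_smul_right] at hab
    exact ((ha y hy).trans hab).le
  choose θ b hθ hb hy using key
  have hcpt : IsCompact (Metric.sphere (0 : Space n) 1 ×ˢ Metric.closedBall (0 : Space n) 1) :=
    (isCompact_sphere _ _).prod (isCompact_closedBall _ _)
  obtain ⟨⟨u, c⟩, ⟨hu, hc⟩, φ, hφ, hlim⟩ := hcpt.tendsto_subseq (x := fun k => (θ k, b k))
    fun k => ⟨mem_sphere_zero_iff_norm.2 (hθ k), mem_closedBall_zero_iff.2 (hb k)⟩
  have hu1 : ‖u‖ = 1 := mem_sphere_zero_iff_norm.1 hu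
  have hc1 : ‖c‖ ≤ 1 := mem_closedBall_zero_iff.1 hc
  have hθl : Tendsto (fun k => θ (φ k)) atTop (𝓝 u) := (continuous_fst.tendsto _).comp hlim
  have hbl : Tendsto (fun k => b (φ k)) atTop (𝓝 c) := (continuous_snd.tendsto _).comp hlim
  have hLl : Tendsto (fun k => ⟪θ (φ k), L (b (φ k))⟫) atTop (𝓝 ⟪u, L c⟫) :=
    hθl.inner ((L.continuous.tendsto c).comp hbl)
  have hK1 : ∀ y ∈ K, ⟪u, y⟫ ≤ ⟪u, c⟫ := by
    intro y hyK
    have h1 : Tendsto (fun k => ⟪θ (φ k), b (φ k)⟫ + ε (φ k) * ⟪θ (φ k), L (b (φ k))⟫) atTop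
        (𝓝 (⟪u, c⟫ + 0 * ⟪u, L c⟫)) :=
      (hθl.inner hbl).add ((hεlim.comp hφ.tendsto_atTop).mul hLl)
    rw [zero_mul, add_zero] at h1
    exact le_of_tendsto_of_tendsto' (hθl.inner tendsto_const_nhds) h1 fun k => hy (φ k) y hyK
  have huc : ⟪u, c⟫ ≤ 1 := by
    have := real_inner_le_norm u c
    rw [hu1, one_mul] at this
    exact this.trans hc1
  -- In the limit ⟪u, c⟫ = 1 with both norms at most 1: equality in Cauchy–Schwarz.
  have hcu : c = u := by
    have h1 : 1 ≤ ⟪u, c⟫ := by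
      have := hK1 u (hball u hu1.le)
      rwa [real_inner_self_eq_norm_sq, hu1, one_pow] at this
    have h2 : ‖u - c‖ ^ 2 ≤ 0 := by
      rw [norm_sub_sq_real, hu1]
      nlinarith [norm_nonneg c]
    have h3 : ‖u - c‖ = 0 := by nlinarith [norm_nonneg (u - c)]
    exact (sub_eq_zero.1 (norm_eq_zero.1 h3)).symm
  rw [hcu] at hLl
  refine ⟨u, hu1, fun y hyK => (hK1 y hyK).trans huc, ge_of_tendsto' hLl fun k => ?_⟩
  -- Testing with y = θ gives 1 ≤ ⟪θ, b⟫ + ε ⟪θ, L b⟫ ≤ 1 + ε ⟪θ, L b⟫, so the second term is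
  -- nonnegative before the limit.
  have h1 := hy (φ k) _ (hball (θ (φ k)) (hθ _).le)
  have h2 := real_inner_le_norm (θ (φ k)) (b (φ k))
  rw [hθ, one_mul] at h2
  rw [real_inner_self_eq_norm_sq, hθ] at h1
  have h3 := hb (φ k)
  have h4 : 0 ≤ ε (φ k) * ⟪θ (φ k), L (b (φ k))⟫ := by linarith
  exact nonneg_of_mul_nonneg_right h4 (hε0 _)

/-- **John's decomposition of the identity**. -/
theorem InJohnPosition.exists_decomposition {n : ℕ} {K : ConvexBody (Space n)}
    (hK : InJohnPosition K) :
    ∃ (ι : Type) (_ : Fintype ι) (c : ι → ℝ) (u : ι → Space n), (∀ i, 0 ≤ c i) ∧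
      (∀ i, ‖u i‖ = 1) ∧ (∀ i, ∀ x ∈ K, ⟪u i, x⟫ ≤ 1) ∧
      ∀ k l, ∑ i, c i * (u i k * u i l) = (1 : Matrix (Fin n) (Fin n) ℝ) k l := by
  rcases Nat.eq_zero_or_pos n with rfl | hn
  · exact ⟨Empty, inferInstance, Empty.elim, Empty.elim, by simp, by simp, by simp,
      fun k => k.elim0⟩
  have hn0 : (n : ℝ) ≠ 0 := by exact_mod_cast hn.ne'
  set C : Set (Space n) := {u | ‖u‖ = 1 ∧ ∀ x ∈ K, ⟪u, x⟫ ≤ 1}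
  set τ : Space n → Fin n → Fin n → ℝ := fun u k l => u k * u l
  have hCc : IsCompact C := by
    have hcl : IsClosed {u : Space n | ∀ x ∈ K, ⟪u, x⟫ ≤ 1} := by
      simp only [ofPred_forall]
      exact isClosed_iInter fun x => isClosed_iInter fun _ =>
        isClosed_le (by fun_prop) continuous_const
    have : C = Metric.sphere 0 1 ∩ {u | ∀ x ∈ K, ⟪u, x⟫ ≤ 1} := by
      ext u; simp [C]
    rw [this]
    exact (isCompact_sphere _ _).inter_right hcl
  have hτ : Continuous τ := by fun_prop
  set P : Fin n → Fin n → ℝ := fun k l => (n : ℝ)⁻¹ * (1 : Matrix (Fin n) (Fin n) ℝ) k l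
  have hP : P ∈ convexHull ℝ (τ '' C) := by
    by_contra hP
    obtain ⟨f, α, hf, hα⟩ := geometric_hahn_banach_closed_point (convex_convexHull ℝ (τ '' C))
      (isCompact_convexHull (hCc.image hτ)).isClosed hP
    set m : Matrix (Fin n) (Fin n) ℝ := fun k l => f (Pi.single k (Pi.single l 1))
    have hfm : ∀ A : Fin n → Fin n → ℝ, f A = ∑ k, ∑ l, A k l * m k l := by
      intro A
      have : A = ∑ k, ∑ l, A k l • (Pi.single k (Pi.single l (1 : ℝ)) : Fin n → Fin n → ℝ) := by
        ext k l
        simp [Finset.sum_apply, Pi.single_apply, apply_ite, ite_apply]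
      conv_lhs => rw [this]
      simp [map_sum, m]
    -- If I/n were separated from the contact tensors by `f` at level `α`, then `M` would have
    -- positive trace and ⟪u, M u⟫ = f(u ⊗ u) - α < 0 at every contact point, against
    -- `exists_contact`.
    set M := m - α • (1 : Matrix (Fin n) (Fin n) ℝ)
    have htr : 0 < M.trace := by
      have h1 : f P = (n : ℝ)⁻¹ * m.trace := by
        rw [hfm, Matrix.trace, Finset.mul_sum]
        refine Finset.sum_congr rfl fun k _ => ?_
        simp [P, Matrix.one_apply]
      rw [h1, inv_mul_eq_div, lt_div_iff₀ (by positivity)] at hα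
      simp only [M, Matrix.trace_sub, Matrix.trace_smul, Matrix.trace_one, Fintype.card_fin,
        smul_eq_mul]
      linarith
    obtain ⟨u, hu1, huK, hu⟩ := hK.exists_contact M htr
    have h1 := hf _ (subset_convexHull ℝ _ (mem_image_of_mem τ ⟨hu1, huK⟩))
    have h2 : ⟪u, Matrix.toEuclideanCLM (𝕜 := ℝ) M u⟫ = f (τ u) - α * ‖u‖ ^ 2 := by
      have : Matrix.toEuclideanCLM (𝕜 := ℝ) M u =
          Matrix.toEuclideanCLM (𝕜 := ℝ) m u - α • u := by simp [M]
      rw [this, inner_sub_right, real_inner_smul_right, real_inner_self_eq_norm_sq, hfm,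
        PiLp.inner_apply]
      simp only [Matrix.ofLp_toEuclideanCLM, Matrix.mulVec, dotProduct, RCLike.inner_apply,
        conj_trivial, τ, Finset.sum_mul]
      congr 1
      exact Finset.sum_congr rfl fun k _ => Finset.sum_congr rfl fun l _ => by ring
    rw [h2, hu1] at hu
    linarith
  obtain ⟨ι, _, w, z, hw, -, hz, hsum⟩ := mem_convexHull_iff_exists_fintype.1 hP
  choose u hu huz using hz
  refine ⟨ι, inferInstance, fun i => n * w i, u, fun i => mul_nonneg (Nat.cast_nonneg n) (hw i),
    fun i => (hu i).1, fun i => (hu i).2, fun k l => ?_⟩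
  have h1 := congrFun (congrFun hsum k) l
  simp only [Finset.sum_apply, Pi.smul_apply, smul_eq_mul, P, ← huz, τ] at h1
  simp_rw [mul_assoc, ← Finset.mul_sum]
  rw [h1]
  field_simp

/-! ### Monotone transport on the line -/

theorem integral_pos_of_continuous_pos {f : ℝ → ℝ} (hpos : ∀ t, 0 < f t)
    (hint : Integrable f) : 0 < ∫ t, f t := by
  rw [MeasureTheory.integral_pos_iff_support_of_nonneg (fun t => (hpos t).le) hint]
  have : Function.support f = univ := by
    ext t; simp [(hpos t).ne']
  simp [this]

theorem exists_primitive {f : ℝ → ℝ} (hf : Continuous f) (hpos : ∀ t, 0 < f t)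
    (hint : Integrable f) : ∃ F : ℝ → ℝ, (∀ t, HasDerivAt F (f t) t) ∧ StrictMono F ∧
      range F = Ioo 0 (∫ t, f t) := by
  -- The constant makes `F` the distribution function, with limit 0 at -∞.
  set F : ℝ → ℝ := fun t => (∫ x in Iic 0, f x) + ∫ x in (0 : ℝ)..t, f x
  have hd : ∀ t, HasDerivAt F (f t) t := fun t =>
    (hf.integral_hasStrictDerivAt 0 t).hasDerivAt.const_add _
  have hmono : StrictMono F := strictMono_of_hasDerivAt_pos hd hpos
  have hcont : Continuous F := continuous_iff_continuousAt.2 fun t => (hd t).continuousAt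
  have htop : Tendsto F atTop (𝓝 (∫ t, f t)) := by
    rw [← intervalIntegral.integral_Iic_add_Ioi (b := 0) hint.integrableOn hint.integrableOn]
    exact (intervalIntegral_tendsto_integral_Ioi 0 hint.integrableOn tendsto_id).const_add _
  have hbot : Tendsto F atBot (𝓝 0) := by
    have h := (intervalIntegral_tendsto_integral_Iic 0 (hint.integrableOn (s := Iic 0))
      tendsto_id).const_sub (∫ x in Iic 0, f x)
    rw [sub_self] at h
    refine h.congr fun t => ?_
    simp only [F, id]
    rw [intervalIntegral.integral_symm 0 t]; ring
  refine ⟨F, hd, hmono, Subset.antisymm ?_ fun y hy => ?_⟩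
  · rintro _ ⟨t, rfl⟩
    exact ⟨(hmono.monotone.le_of_tendsto hbot (t - 1)).trans_lt (hmono (by linarith)),
      (hmono (by linarith : t < t + 1)).trans_le (hmono.monotone.ge_of_tendsto htop _)⟩
  · exact mem_range_of_exists_le_of_exists_ge hcont
      (hbot.eventually_le_const hy.1).exists (htop.eventually_const_le hy.2).exists

/-- Monotone transport between two positive continuous densities on the line. -/
theorem exists_monotone_transport {f g : ℝ → ℝ} (hf : Continuous f) (hg : Continuous g)
    (hfpos : ∀ t, 0 < f t) (hgpos : ∀ t, 0 < g t) (hfint : Integrable f) (hgint : Integrable g)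
    (heq : ∫ t, f t = ∫ t, g t) :
    ∃ T T' : ℝ → ℝ, StrictMono T ∧ (∀ t, HasDerivAt T (T' t) t) ∧ (∀ t, 0 < T' t) ∧
      ∀ t, f t = T' t * g (T t) := by
  obtain ⟨F, hF, hFm, hFr⟩ := exists_primitive hf hfpos hfint
  obtain ⟨G, hG, hGm, hGr⟩ := exists_primitive hg hgpos hgint
  have hr : range F = range G := by rw [hFr, hGr, heq]
  have hex : ∀ t, ∃ s, G s = F t := fun t => by
    have : F t ∈ range G := hr ▸ mem_range_self t
    exact this
  choose T hT using hex
  set H : ℝ → ℝ := Function.invFun G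
  have hHG : ∀ s, H (G s) = s := Function.leftInverse_invFun hGm.injective
  have hGH : ∀ y ∈ range G, G (H y) = y := by rintro _ ⟨s, rfl⟩; rw [hHG]
  have hTH : T = H ∘ F := by
    funext t; rw [Function.comp, ← hT, hHG]
  have hnhds : ∀ t, range G ∈ 𝓝 (F t) := fun t => by
    have : F t ∈ Ioo 0 (∫ t, g t) := by rw [← hGr, ← hr]; exact mem_range_self t
    rw [hGr]; exact isOpen_Ioo.mem_nhds this
  have hHmono : MonotoneOn H (range G) := by
    rintro _ ⟨a, rfl⟩ _ ⟨b, rfl⟩ hab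
    rw [hHG, hHG]; exact hGm.le_iff_le.1 hab
  have hHim : H '' range G = univ := by
    ext s
    simp only [mem_univ, iff_true]
    exact ⟨G s, mem_range_self s, hHG s⟩
  -- A monotone function whose image is the whole line has no jumps; this continuity is what the
  -- inverse function rule needs.
  have hHcont : ∀ t, ContinuousAt H (F t) := fun t =>
    continuousAt_of_monotoneOn_of_image_mem_nhds hHmono (hnhds t) (by rw [hHim]; exact univ_mem)
  have hHd : ∀ t, HasDerivAt H (g (T t))⁻¹ (F t) := fun t => by
    refine HasDerivAt.of_local_left_inverse (f := G) (hHcont t) ?_ (hgpos _).ne' ?_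
    · rw [← hT, hHG]; exact hG _
    · filter_upwards [hnhds t] with y hy using hGH y hy
  refine ⟨T, fun t => (g (T t))⁻¹ * f t, fun a b hab => ?_, fun t => ?_,
    fun t => mul_pos (inv_pos.2 (hgpos _)) (hfpos t), fun t => ?_⟩
  · rw [← hGm.lt_iff_lt, hT, hT]; exact hFm hab
  · have := (hHd t).comp t (hF t)
    rwa [← hTH] at this
  · have := (hgpos (T t)).ne'
    field_simp

/-! ### The geometric Brascamp–Lieb inequality -/

section Decomposition

variable {E : Type*} [NormedAddCommGroup E] [InnerProductSpace ℝ E]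
  {ι : Type*} [Fintype ι] {c : ι → ℝ} {u : ι → E}

theorem sum_mul_inner_mul_inner (hI : ∀ x, ∑ i, (c i * ⟪u i, x⟫) • u i = x) (x y : E) :
    ∑ i, c i * (⟪u i, x⟫ * ⟪u i, y⟫) = ⟪x, y⟫ := by
  conv_rhs => rw [← hI x, sum_inner]
  simp only [real_inner_smul_left, mul_assoc]

theorem sum_mul_inner_sq (hI : ∀ x, ∑ i, (c i * ⟪u i, x⟫) • u i = x) (x : E) :
    ∑ i, c i * ⟪u i, x⟫ ^ 2 = ‖x‖ ^ 2 := by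
  simp only [sq, sum_mul_inner_mul_inner hI, real_inner_self_eq_norm_mul_norm]

/-- Pairing the sum `y` with itself and using 2ab ≤ a² + b² bounds ‖y‖² by half of Σ c_i s_i² +
‖y‖². -/
theorem norm_sum_smul_sq_le (hc : ∀ i, 0 ≤ c i)
    (hI : ∀ x, ∑ i, (c i * ⟪u i, x⟫) • u i = x) (s : ι → ℝ) :
    ‖∑ i, (c i * s i) • u i‖ ^ 2 ≤ ∑ i, c i * s i ^ 2 := by
  set y := ∑ i, (c i * s i) • u i
  have h1 : ‖y‖ ^ 2 = ∑ i, c i * s i * ⟪u i, y⟫ := by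
    rw [← real_inner_self_eq_norm_sq]
    conv_lhs => rw [show ⟪y, y⟫ = ⟪∑ i, (c i * s i) • u i, y⟫ from rfl, sum_inner]
    simp only [real_inner_smul_left]
  have h2 : ∑ i, c i * s i * ⟪u i, y⟫ ≤ ∑ i, (c i * s i ^ 2 + c i * ⟪u i, y⟫ ^ 2) / 2 := by
    refine Finset.sum_le_sum fun i _ => ?_
    nlinarith [mul_nonneg (hc i) (sq_nonneg (s i - ⟪u i, y⟫))]
  rw [← Finset.sum_div, Finset.sum_add_distrib, sum_mul_inner_sq hI, ← h1] at h2
  linarith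

/-- The map is monotone: pairing the difference of two values with `x - y` gives a sum of
nonnegative terms. If it vanishes, every term with c_i ≠ 0 has ⟪u_i, x - y⟫ = 0, so ‖x - y‖² = 0. -/
theorem injective_sum_smul_of_strictMono (hc : ∀ i, 0 ≤ c i)
    (hI : ∀ x, ∑ i, (c i * ⟪u i, x⟫) • u i = x) {T : ι → ℝ → ℝ} (hT : ∀ i, StrictMono (T i)) :
    Function.Injective fun x : E => ∑ i, (c i * T i ⟪u i, x⟫) • u i := by
  intro x y hxy
  have h1 : ∑ i, c i * ((T i ⟪u i, x⟫ - T i ⟪u i, y⟫) * (⟪u i, x⟫ - ⟪u i, y⟫)) = 0 := by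
    have h2 : ⟪∑ i, (c i * T i ⟪u i, x⟫) • u i - ∑ i, (c i * T i ⟪u i, y⟫) • u i, x - y⟫ = 0 := by
      simp only at hxy
      rw [hxy, sub_self, inner_zero_left]
    rw [← h2, ← Finset.sum_sub_distrib, sum_inner]
    refine Finset.sum_congr rfl fun i _ => ?_
    rw [← sub_smul, real_inner_smul_left, inner_sub_right]
    ring
  have hnn : ∀ i, 0 ≤ (T i ⟪u i, x⟫ - T i ⟪u i, y⟫) * (⟪u i, x⟫ - ⟪u i, y⟫) := by
    intro i
    rcases le_total ⟪u i, x⟫ ⟪u i, y⟫ with h | h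
    · exact mul_nonneg_of_nonpos_of_nonpos (sub_nonpos.2 ((hT i).monotone h)) (sub_nonpos.2 h)
    · exact mul_nonneg (sub_nonneg.2 ((hT i).monotone h)) (sub_nonneg.2 h)
  have h3 := (Finset.sum_eq_zero_iff_of_nonneg fun i _ => mul_nonneg (hc i) (hnn i)).1 h1
  have h4 : ‖x - y‖ ^ 2 = 0 := by
    rw [← sum_mul_inner_sq hI]
    refine Finset.sum_eq_zero fun i hi => ?_
    rcases mul_eq_zero.1 (h3 i hi) with h | h
    · simp [h]
    · have : ⟪u i, x⟫ = ⟪u i, y⟫ := by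
        rcases mul_eq_zero.1 h with h | h
        · exact (hT i).injective (sub_eq_zero.1 h)
        · exact sub_eq_zero.1 h
      rw [inner_sub_right, this]; simp
  exact sub_eq_zero.1 (norm_eq_zero.1 (pow_eq_zero_iff two_ne_zero |>.1 h4))

variable [FiniteDimensional ℝ E]

theorem sum_coeff_eq_finrank (hu : ∀ i, ‖u i‖ = 1)
    (hI : ∀ x, ∑ i, (c i * ⟪u i, x⟫) • u i = x) : ∑ i, c i = Module.finrank ℝ E := by
  have b := stdOrthonormalBasis ℝ E
  have h1 : ∑ k, ∑ i, c i * ⟪u i, b k⟫ ^ 2 = Module.finrank ℝ E := by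
    simp [sum_mul_inner_sq hI]
  rw [← h1, Finset.sum_comm]
  refine Finset.sum_congr rfl fun i _ => ?_
  have := b.sum_sq_norm_inner_left (u i)
  simp only [Real.norm_eq_abs, sq_abs, hu i] at this
  rw [← Finset.mul_sum, this]; simp

/-- Ball's determinant inequality. -/
theorem prod_rpow_le_det (hc : ∀ i, 0 ≤ c i) (hu : ∀ i, ‖u i‖ = 1)
    (hI : ∀ x, ∑ i, (c i * ⟪u i, x⟫) • u i = x) {t : ι → ℝ} (ht : ∀ i, 0 < t i)
    {A : E →ₗ[ℝ] E} (hA : ∀ x, A x = ∑ i, (c i * t i * ⟪u i, x⟫) • u i) :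
    ∏ i, t i ^ c i ≤ LinearMap.det A := by
  have hinner : ∀ x y, ⟪A x, y⟫ = ∑ i, c i * t i * (⟪u i, x⟫ * ⟪u i, y⟫) := by
    intro x y
    rw [hA, sum_inner]
    simp only [real_inner_smul_left, mul_assoc]
  have hsymm : A.IsSymmetric := by
    intro x y
    rw [real_inner_comm (A y) x, hinner, hinner]
    exact Finset.sum_congr rfl fun i _ => by ring
  rw [hsymm.det_eq_prod_eigenvalues rfl]
  set b := hsymm.eigenvectorBasis rfl
  have heig : ∀ k, hsymm.eigenvalues rfl k = ∑ i, c i * ⟪u i, b k⟫ ^ 2 * t i := by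
    intro k
    have h1 : ⟪A (b k), b k⟫ = hsymm.eigenvalues rfl k := by
      rw [hsymm.apply_eigenvectorBasis, real_inner_smul_left, real_inner_self_eq_norm_sq,
        b.norm_eq_one]
      simp
    rw [← h1, hinner]
    exact Finset.sum_congr rfl fun i _ => by ring
  -- In an eigenbasis of `A`, Σ_k ⟪u_i, b_k⟫² = 1 splits the exponents. For each k the weights c_i
  -- ⟪u_i, b_k⟫² sum to 1 over i, so weighted AM–GM bounds the k-th factor by the k-th eigenvalue.
  calc ∏ i, t i ^ c i = ∏ i, ∏ k, t i ^ (c i * ⟪u i, b k⟫ ^ 2) := by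
        refine Finset.prod_congr rfl fun i _ => ?_
        rw [← Real.rpow_sum_of_pos (ht i), ← Finset.mul_sum]
        have := b.sum_sq_norm_inner_left (u i)
        simp only [Real.norm_eq_abs, sq_abs, hu i] at this
        rw [this]; simp
    _ = ∏ k, ∏ i, t i ^ (c i * ⟪u i, b k⟫ ^ 2) := Finset.prod_comm
    _ ≤ ∏ k, hsymm.eigenvalues rfl k := by
        refine Finset.prod_le_prod
          (fun k _ => Finset.prod_nonneg fun i _ => Real.rpow_nonneg (ht i).le _) fun k _ => ?_
        rw [heig]
        refine Real.geom_mean_le_arith_mean_weighted _ _ _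
          (fun i _ => mul_nonneg (hc i) (sq_nonneg _)) ?_ fun i _ => (ht i).le
        rw [sum_mul_inner_sq hI, b.norm_eq_one, one_pow]

variable [MeasurableSpace E] [BorelSpace E]

theorem integrable_exp_neg_pi_mul_sq :
    Integrable fun t : ℝ => Real.exp (-Real.pi * t ^ 2) :=
  integrable_exp_neg_mul_sq Real.pi_pos

theorem lintegral_exp_neg_pi_mul_norm_sq :
    ∫⁻ x : E, ENNReal.ofReal (Real.exp (-Real.pi * ‖x‖ ^ 2)) = 1 := by
  have h := GaussianFourier.integral_rexp_neg_mul_sq_norm (V := E) Real.pi_pos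
  rw [div_self Real.pi_pos.ne', Real.one_rpow] at h
  rw [← ofReal_integral_eq_lintegral_ofReal _
    (Eventually.of_forall fun x => (Real.exp_pos _).le), h, ENNReal.ofReal_one]
  -- A non-integrable function would have integral 0 by convention, whereas the value is 1.
  by_contra hint
  rw [integral_undef hint] at h
  exact zero_ne_one h

/-- The geometric **Brascamp–Lieb inequality** of Ball, for positive continuous functions. -/
theorem lintegral_prod_rpow_le (hc : ∀ i, 0 ≤ c i) (hu : ∀ i, ‖u i‖ = 1)
    (hI : ∀ x, ∑ i, (c i * ⟪u i, x⟫) • u i = x) {f : ι → ℝ → ℝ} (hf : ∀ i, Continuous (f i))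
    (hpos : ∀ i t, 0 < f i t) (hint : ∀ i, Integrable (f i)) :
    ∫⁻ x : E, ENNReal.ofReal (∏ i, f i ⟪u i, x⟫ ^ c i) ≤
      ENNReal.ofReal (∏ i, (∫ t, f i t) ^ c i) := by
  set J : ι → ℝ := fun i => ∫ t, f i t
  have hJ : ∀ i, 0 < J i := fun i => integral_pos_of_continuous_pos (hpos i) (hint i)
  have htr : ∀ i, ∃ T T' : ℝ → ℝ, StrictMono T ∧ (∀ t, HasDerivAt T (T' t) t) ∧
      (∀ t, 0 < T' t) ∧ ∀ t, f i t / J i = T' t * Real.exp (-Real.pi * T t ^ 2) := by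
    intro i
    refine exists_monotone_transport (f := fun t => f i t / J i)
      (g := fun t => Real.exp (-Real.pi * t ^ 2)) ((hf i).div_const _) (by fun_prop)
      (fun t => div_pos (hpos i t) (hJ i)) (fun t => Real.exp_pos _) ((hint i).div_const _)
      integrable_exp_neg_pi_mul_sq ?_
    rw [integral_div, integral_gaussian, div_self (hJ i).ne', div_self Real.pi_pos.ne',
      Real.sqrt_one]
  choose T T' hTm hTd hT'pos hTf using htr
  -- The one-dimensional transports of the normalized `f i` to the Gaussian are assembled into one
  -- map of `E`. Ball's inequality bounds its Jacobian below, and `norm_sum_smul_sq_le` bounds the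
  -- Gaussian at `Φ x` below.
  set Φ : E → E := fun x => ∑ i, (c i * T i ⟪u i, x⟫) • u i
  set Φ' : E → E →L[ℝ] E := fun x =>
    ∑ i, ((c i * T' i ⟪u i, x⟫) • innerSL ℝ (u i)).smulRight (u i)
  have hΦ' : ∀ x, HasFDerivAt Φ (Φ' x) x := by
    intro x
    refine HasFDerivAt.fun_sum fun i _ => ?_
    have h1 : HasFDerivAt (fun y => ⟪u i, y⟫) (innerSL ℝ (u i)) x := (innerSL ℝ (u i)).hasFDerivAt
    have h2 := ((hTd i ⟪u i, x⟫).comp_hasFDerivAt x h1).const_mul (c i)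
    rw [smul_smul] at h2
    exact h2.smul_const (u i)
  have hdet : ∀ x, ∏ i, T' i ⟪u i, x⟫ ^ c i ≤ |(Φ' x).det| := by
    intro x
    refine (prod_rpow_le_det hc hu hI (t := fun i => T' i ⟪u i, x⟫) (fun i => hT'pos i _)
      (A := (Φ' x : E →ₗ[ℝ] E)) fun y => ?_).trans (le_abs_self _)
    simp [Φ']
  have hpt : ∀ x, ∏ i, f i ⟪u i, x⟫ ^ c i ≤
      (∏ i, J i ^ c i) * (|(Φ' x).det| * Real.exp (-Real.pi * ‖Φ x‖ ^ 2)) := by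
    intro x
    have h1 : ∏ i, f i ⟪u i, x⟫ ^ c i = (∏ i, J i ^ c i) * ((∏ i, T' i ⟪u i, x⟫ ^ c i) *
        Real.exp (-Real.pi * ∑ i, c i * T i ⟪u i, x⟫ ^ 2)) := by
      rw [Finset.mul_sum, Real.exp_sum, ← Finset.prod_mul_distrib, ← Finset.prod_mul_distrib]
      refine Finset.prod_congr rfl fun i _ => ?_
      have h2 : f i ⟪u i, x⟫ =
          J i * (T' i ⟪u i, x⟫ * Real.exp (-Real.pi * T i ⟪u i, x⟫ ^ 2)) := by
        rw [← hTf, mul_div_cancel₀ _ (hJ i).ne']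
      rw [h2, Real.mul_rpow (hJ i).le (mul_nonneg (hT'pos i _).le (Real.exp_pos _).le),
        Real.mul_rpow (hT'pos i _).le (Real.exp_pos _).le, ← Real.exp_mul]
      ring_nf
    rw [h1]
    refine mul_le_mul_of_nonneg_left (mul_le_mul (hdet x) (Real.exp_le_exp.2 ?_)
      (Real.exp_pos _).le (abs_nonneg _))
      (Finset.prod_nonneg fun i _ => Real.rpow_nonneg (hJ i).le _)
    have := norm_sum_smul_sq_le hc hI fun i => T i ⟪u i, x⟫
    nlinarith [Real.pi_pos]
  have hJ0 : 0 ≤ ∏ i, J i ^ c i := Finset.prod_nonneg fun i _ => Real.rpow_nonneg (hJ i).le _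
  have hcov := lintegral_image_eq_lintegral_abs_det_fderiv_mul volume MeasurableSet.univ
    (fun x _ => (hΦ' x).hasFDerivWithinAt)
    (injective_sum_smul_of_strictMono hc hI hTm).injOn
    fun y => ENNReal.ofReal (Real.exp (-Real.pi * ‖y‖ ^ 2))
  calc ∫⁻ x : E, ENNReal.ofReal (∏ i, f i ⟪u i, x⟫ ^ c i)
      ≤ ∫⁻ x : E, ENNReal.ofReal (∏ i, J i ^ c i) * (ENNReal.ofReal |(Φ' x).det| *
          ENNReal.ofReal (Real.exp (-Real.pi * ‖Φ x‖ ^ 2))) := by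
        refine lintegral_mono fun x => ?_
        rw [← ENNReal.ofReal_mul (abs_nonneg _), ← ENNReal.ofReal_mul hJ0]
        exact ENNReal.ofReal_le_ofReal (hpt x)
    _ = ENNReal.ofReal (∏ i, J i ^ c i) * ∫⁻ x : E, ENNReal.ofReal |(Φ' x).det| *
          ENNReal.ofReal (Real.exp (-Real.pi * ‖Φ x‖ ^ 2)) :=
        lintegral_const_mul' _ _ ENNReal.ofReal_ne_top
    _ ≤ ENNReal.ofReal (∏ i, J i ^ c i) * 1 := by
        gcongr
        rw [setLIntegral_univ] at hcov
        -- Surjectivity of `Φ` is not needed: the Gaussian mass of its image is at most 1.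
        rw [← hcov, ← lintegral_exp_neg_pi_mul_norm_sq (E := E)]
        exact setLIntegral_le_lintegral _ _
    _ = _ := mul_one _

end Decomposition

/-- The function `exp (-π d(t, [-1,1])²)` on the line. -/
def intervalProfile (t : ℝ) : ℝ := Real.exp (-Real.pi * max (|t| - 1) 0 ^ 2)

/-! ### The interval profile and comparison with the cube -/

theorem continuous_intervalProfile : Continuous intervalProfile := by
  unfold intervalProfile; fun_prop

theorem intervalProfile_pos (t : ℝ) : 0 < intervalProfile t := Real.exp_pos _

theorem integrable_intervalProfile : Integrable intervalProfile := by
  -- With m = max(|t| - 1, 0), t² ≤ (m + 1)² ≤ 2m² + 2 gives domination by e^π exp(-π t²/2).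
  refine ((integrable_exp_neg_mul_sq (half_pos Real.pi_pos)).const_mul (Real.exp Real.pi)).mono'
    continuous_intervalProfile.aestronglyMeasurable (Eventually.of_forall fun t => ?_)
  rw [Real.norm_of_nonneg (intervalProfile_pos t).le, intervalProfile, ← Real.exp_add]
  refine Real.exp_le_exp.2 ?_
  have h1 : |t| ≤ max (|t| - 1) 0 + 1 := by linarith [le_max_left (|t| - 1) 0]
  have h2 : t ^ 2 ≤ (max (|t| - 1) 0 + 1) ^ 2 := by
    rw [← sq_abs t]; exact pow_le_pow_left₀ (abs_nonneg t) h1 2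
  nlinarith [Real.pi_pos, sq_nonneg (max (|t| - 1) 0 - 1)]

theorem sum_smul_eq_self_of_matrix {n : ℕ} {ι : Type*} [Fintype ι] {c : ι → ℝ}
    {u : ι → Space n}
    (h : ∀ k l, ∑ i, c i * (u i k * u i l) = (1 : Matrix (Fin n) (Fin n) ℝ) k l) (x : Space n) :
    ∑ i, (c i * ⟪u i, x⟫) • u i = x := by
  ext k
  have h1 : x k = ∑ l, (1 : Matrix (Fin n) (Fin n) ℝ) k l * x l := by
    simp [Matrix.one_apply]
  rw [h1]
  simp_rw [← h, Finset.sum_mul]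
  rw [Finset.sum_comm]
  simp only [WithLp.ofLp_sum, WithLp.ofLp_smul, Finset.sum_apply, Pi.smul_apply, smul_eq_mul,
    PiLp.inner_apply, RCLike.inner_apply, conj_trivial, Finset.mul_sum, Finset.sum_mul]
  exact Finset.sum_congr rfl fun i _ => Finset.sum_congr rfl fun l _ => by ring

theorem wills_le_integral_pow {n : ℕ} {K : ConvexBody (Space n)}
    (hsymm : (K : Set (Space n)) = -(K : Set (Space n))) (hK : InJohnPosition K) :
    wills K ≤ (∫ t, intervalProfile t) ^ n := by
  obtain ⟨ι, _, c, u, hc, hu, huK, hdec⟩ := hK.exists_decomposition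
  have hI := sum_smul_eq_self_of_matrix hdec
  have hJ := integral_pos_of_continuous_pos intervalProfile_pos integrable_intervalProfile
  have habs : ∀ i, ∀ y ∈ K, |⟪u i, y⟫| ≤ 1 := by
    intro i y hy
    refine abs_le.2 ⟨?_, huK i y hy⟩
    have hy' : -y ∈ (K : Set (Space n)) := by rw [hsymm]; simpa using hy
    have := huK i _ hy'
    rw [inner_neg_right] at this
    linarith
  have hpt : ∀ x, Real.exp (-Real.pi * Metric.infDist x (K : Set (Space n)) ^ 2) ≤
      ∏ i, intervalProfile ⟪u i, x⟫ ^ c i := by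
    intro x
    obtain ⟨y, hy, hxy⟩ := K.isCompact.exists_infDist_eq_dist K.nonempty x
    simp only [intervalProfile]
    simp_rw [← Real.exp_mul]
    rw [← Real.exp_sum, hxy, dist_eq_norm, ← sum_mul_inner_sq hI]
    refine Real.exp_le_exp.2 ?_
    rw [Finset.mul_sum]
    refine Finset.sum_le_sum fun i _ => ?_
    have h1 : max (|⟪u i, x⟫| - 1) 0 ≤ |⟪u i, x - y⟫| := by
      refine max_le ?_ (abs_nonneg _)
      rw [inner_sub_right]
      linarith [abs_sub_abs_le_abs_sub ⟪u i, x⟫ ⟪u i, y⟫, habs i y hy]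
    have h2 : max (|⟪u i, x⟫| - 1) 0 ^ 2 ≤ ⟪u i, x - y⟫ ^ 2 := by
      rw [← sq_abs ⟪u i, x - y⟫]
      exact pow_le_pow_left₀ (le_max_right _ _) h1 2
    have h3 := mul_le_mul_of_nonneg_left h2 (mul_nonneg Real.pi_pos.le (hc i))
    linarith
  rw [← ENNReal.ofReal_le_ofReal_iff (by positivity), ← lintegral_exp_neg_infDist_sq]
  refine (lintegral_mono fun x => ENNReal.ofReal_le_ofReal (hpt x)).trans ?_
  refine (lintegral_prod_rpow_le hc hu hI (f := fun _ => intervalProfile)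
    (fun _ => continuous_intervalProfile) (fun _ => intervalProfile_pos)
    fun _ => integrable_intervalProfile).trans (le_of_eq ?_)
  rw [← Real.rpow_sum_of_pos hJ, sum_coeff_eq_finrank hu hI, finrank_euclideanSpace_fin,
    Real.rpow_natCast]

theorem infDist_cube_sq_le {n : ℕ} (x : Space n) :
    Metric.infDist x (cube n : Set (Space n)) ^ 2 ≤ ∑ i, max (|x i| - 1) 0 ^ 2 := by
  -- Clamping each coordinate to [-1,1] gives the candidate nearest point; an upper bound on the
  -- distance suffices.
  set y : Space n := WithLp.toLp 2 fun i => max (-1) (min 1 (x i))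
  have hy : y ∈ (cube n : Set (Space n)) := fun i =>
    ⟨le_max_left _ _, max_le (by norm_num) (min_le_left _ _)⟩
  refine (pow_le_pow_left₀ Metric.infDist_nonneg (Metric.infDist_le_dist_of_mem hy) 2).trans ?_
  rw [EuclideanSpace.dist_eq, Real.sq_sqrt (Finset.sum_nonneg fun i _ => sq_nonneg _)]
  refine Finset.sum_le_sum fun i _ => pow_le_pow_left₀ dist_nonneg ?_ 2
  rw [Real.dist_eq]
  change |x i - max (-1) (min 1 (x i))| ≤ _
  rcases le_total (x i) 1 with h1 | h1
  · rcases le_total (-1) (x i) with h2 | h2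
    · simp [h1, h2]
    · rw [min_eq_right h1, max_eq_left h2, abs_of_nonpos (by linarith), abs_of_nonpos (by linarith)]
      exact le_max_of_le_left (by linarith)
  · rw [min_eq_left h1, max_eq_right (by norm_num), abs_of_nonneg (by linarith),
      abs_of_nonneg (by linarith)]
    exact le_max_left _ _

theorem integral_pow_le_wills_cube (n : ℕ) :
    (∫ t, intervalProfile t) ^ n ≤ wills (cube n) := by
  have hJ := integral_pos_of_continuous_pos intervalProfile_pos integrable_intervalProfile
  have h1 : ENNReal.ofReal ((∫ t, intervalProfile t) ^ n) =
      ∫⁻ x : Space n, ENNReal.ofReal (∏ i, intervalProfile (x i)) := by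
    have hmp := EuclideanSpace.volume_preserving_symm_measurableEquiv_toLp (Fin n)
    have h2 := hmp.lintegral_comp_emb (MeasurableEquiv.measurableEmbedding _)
      fun x : Fin n → ℝ => ENNReal.ofReal (∏ i, intervalProfile (x i))
    refine Eq.trans ?_ h2.symm
    have h3 := integral_fintype_prod_volume_eq_pow (ι := Fin n) intervalProfile
    rw [Fintype.card_fin] at h3
    rw [← h3]
    exact ofReal_integral_eq_lintegral_ofReal
      (Integrable.fintype_prod fun _ => integrable_intervalProfile)
      (Eventually.of_forall fun x => Finset.prod_nonneg fun i _ => (intervalProfile_pos _).le)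
  have h2 : ENNReal.ofReal ((∫ t, intervalProfile t) ^ n) ≤ ENNReal.ofReal (wills (cube n)) := by
    rw [h1, ← lintegral_exp_neg_infDist_sq]
    refine lintegral_mono fun x => ENNReal.ofReal_le_ofReal ?_
    simp only [intervalProfile]
    rw [← Real.exp_sum, ← Finset.mul_sum]
    refine Real.exp_le_exp.2 ?_
    have := mul_le_mul_of_nonneg_left (infDist_cube_sq_le x) Real.pi_pos.le
    linarith
  rcases ENNReal.ofReal_le_ofReal_iff'.1 h2 with h | h
  · exact h
  · exact absurd h (not_le.2 (by positivity))

end Wills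

end

/-- Among the `0`-symmetric convex bodies in John position, the cube `[-1,1]ⁿ` maximizes the
Wills functional. -/
theorem theorem1p4 (n : ℕ) (K : ConvexBody (Wills.Space n))
    (hsymm : (K : Set (Wills.Space n)) = -(K : Set (Wills.Space n)))
    (hJohn : Wills.InJohnPosition K) :
    Wills.wills K ≤ Wills.wills (Wills.cube n) :=
  (Wills.wills_le_integral_pow hsymm hJohn).trans (Wills.integral_pow_le_wills_cube n)
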